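/- Let $a,b,a_1,b_1:[0,\infty)\to\mathbb R$ be Lebesgue measurable and essentially bounded, with $a(t)\ge 0$ and $b(t)\ge 0$. Let $g,h:[0,\infty)\to\mathbb R$ be Lebesgue measurable with $g(t)\le t$, $h(t)\le t$ for $t\ge 0$, $\limsup_{t\to\infty}(t-g(t))<\infty$ and $\limsup_{t\to\infty}(t-h(t))<\infty$. Consider the delay equation $$\ddot x(t)+a(t)\dot x(t)+b(t)x(t)+a_1(t)\dot x(g(t))+b_1(t)x(h(t))=0 \qquad (2)$$ and the ordinary differential equation $$\ddot x(t)+a(t)\dot x(t)+b(t)x(t)=0. \qquad (11)$$ For $\tau_0\ge 0$, bounded Borel functions $\varphi,\psi:(-\infty,\tau_0)\to\mathbb R$ and $x_0,x_0'\in\mathbb R$, a solution of (2) with these initial data is a function $x:\mathbb R\to\mathbb R$ that is differentiable on $[\tau_0,\infty)$ with locally absolutely continuous derivative $\dot x$ there, satisfies (2) for almost every $t\ge\tau_0$, and has $x(t)=\varphi(t)$ for $t<\tau_0$, $x(\tau_0)=x_0$, $\dot x(\tau_0)=x_0'$; for arguments $t<\tau_0$ the symbol $\dot x(t)$ in (2)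 stands for $\psi(t)$. Equation (2) is called exponentially stable if there are $M>0$, $\mu>0$, independent of $\tau_0$ and of the initial data, such that every such solution satisfies $$|x(t)|\le M e^{-\mu(t-\tau_0)}\Big[|x_0|+|x_0'|+\sup_{s<\tau_0}\big(|\varphi(s)|+|\psi(s)|\big)\Big],\qquad t\ge \tau_0 .$$ Equation (11) is the special case $a_1=b_1=0$ of (2). For $s\ge 0$ let $Y(\cdot,s)$ be the solution of (11) on $[s,\infty)$ with $Y(s,s)=0$, $Y'_t(s,s)=1$, extended by $0$ to $t<s$ (the fundamental function of (11)). Theorem. Suppose that (11) is exponentially stable and that for some $t_0\ge 0$ $$\|a_1\|\,Y'+\|b_1\|\,Y<1,$$ where $\|\cdot\|$ is the norm of $L_\infty[t_0,\infty)$ and $$Y=\sup_{t>t_0}\int_{t_0}^t|Y(t,s)|\,ds,\qquad Y'=\sup_{t>t_0}\int_{t_0}^t|Y'_t(t,s)|\,ds .$$ Then (2) is exponentially stable. -/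

import Mathlib

open MeasureTheory
open scoped ENNReal

noncomputable section

namespace DelayEq

/-- The pair `(x, v)` is a solution of the initial value problem
`x'' + a x' + b x + a₁ x'(g(t)) + b₁ x(h(t)) = 0` for `t ≥ t₀`, with
`x = φ`, `x' = ψ` on `(-∞, t₀)` and `x(t₀) = x₀`, `x'(t₀) = x₀'`.
Here `v` is the function written `x'` in the equation: it is the derivative of `x` on `[t₀, ∞)`
(one-sided at `t₀`) and the prescribed function `ψ`, which need not be related to `φ`,
on `(-∞, t₀)`. -/
structure IsSolution (a b a₁ b₁ g h : ℝ → ℝ) (t₀ : ℝ) (φ ψ : Set.Iio t₀ → ℝ) (x₀ x₀' : ℝ)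
    (x v : ℝ → ℝ) : Prop where
  history : ∀ s : Set.Iio t₀, x s = φ s
  history_deriv : ∀ s : Set.Iio t₀, v s = ψ s
  initial : x t₀ = x₀
  initial_deriv : v t₀ = x₀'
  hasDeriv : ∀ t, t₀ ≤ t → HasDerivWithinAt x (v t) (Set.Ici t₀) t
  locallyAC : ∀ T, t₀ ≤ T → AbsolutelyContinuousOnInterval v t₀ T
  equation : ∀ᵐ t ∂volume.restrict (Set.Ici t₀),
    HasDerivAt v (-(a t * v t + b t * x t + a₁ t * v (g t) + b₁ t * x (h t))) t

/-- (Uniform) exponential stability of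
`x'' + a x' + b x + a₁ x'(g(t)) + b₁ x(h(t)) = 0`: the constants `M`, `μ` do not depend
on the initial point `t₀ ≥ 0` nor on the (bounded Borel) initial data. -/
def ExpStable (a b a₁ b₁ g h : ℝ → ℝ) : Prop :=
  ∃ M > 0, ∃ μ > 0, ∀ t₀ : ℝ, 0 ≤ t₀ →
    ∀ φ ψ : Set.Iio t₀ → ℝ, Measurable φ → Measurable ψ →
      (∃ C, ∀ s, |φ s| ≤ C) → (∃ C, ∀ s, |ψ s| ≤ C) →
    ∀ (x₀ x₀' : ℝ) (x v : ℝ → ℝ), IsSolution a b a₁ b₁ g h t₀ φ ψ x₀ x₀' x v →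
    ∀ t, t₀ ≤ t →
      |x t| ≤ M * Real.exp (-μ * (t - t₀)) * (|x₀| + |x₀'| + ⨆ s, (|φ s| + |ψ s|))

/-- Exponential stability of the ordinary differential equation `x'' + a x' + b x = 0`. -/
def ODEExpStable (a b : ℝ → ℝ) : Prop := ExpStable a b 0 0 id id

open Classical in
/-- The fundamental function `Y(t, s)` of `x'' + a x' + b x = 0`: for each `s ≥ 0`, the function
`Y(·, s)` is the solution with `x = x' = 0` on `(-∞, s)`, `x(s) = 0`, `x'(s) = 1`.
For measurable, essentially bounded `a`, `b` this solution exists and is unique. -/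
def fundamental (a b : ℝ → ℝ) (t s : ℝ) : ℝ :=
  if H : ∃ x v : ℝ → ℝ, IsSolution a b 0 0 id id s 0 0 0 1 x v then H.choose t else 0

/-- `sup_{t > t₀} ∫_{t₀}^t |Y(t, s)| ds`. -/
def supInt (a b : ℝ → ℝ) (t₀ : ℝ) : ℝ≥0∞ :=
  ⨆ t : Set.Ioi t₀, ∫⁻ s in Set.Ioc t₀ t, ‖fundamental a b t s‖ₑ

/-- `sup_{t > t₀} ∫_{t₀}^t |∂Y(t, s)/∂t| ds`. -/
def supIntDeriv (a b : ℝ → ℝ) (t₀ : ℝ) : ℝ≥0∞ :=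
  ⨆ t : Set.Ioi t₀, ∫⁻ s in Set.Ioc t₀ t, ‖deriv (fun τ => fundamental a b τ s) t‖ₑ

/-- A delayed argument: Lebesgue measurable on `[0, ∞)`, `g(t) ≤ t`, and
`limsup_{t → ∞} (t - g(t)) < ∞`. -/
structure IsDelay (g : ℝ → ℝ) : Prop where
  measurable : AEMeasurable g (volume.restrict (Set.Ici 0))
  le_self : ∀ t, 0 ≤ t → g t ≤ t
  bounded : Filter.IsBoundedUnder (· ≤ ·) Filter.atTop (fun t => t - g t)

/-- Lebesgue measurable and essentially bounded on `[0, ∞)`. -/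
def IsCoeff (a : ℝ → ℝ) : Prop := MemLp a ∞ (volume.restrict (Set.Ici 0))

end DelayEq

end

/-! Let `f` collect the two delayed terms. Variation of constants gives, past any time `t₁`, `x = y
- ∫ Y(t,s) f(s) ds` and `x' = y' - ∫ Y'_t(t,s) f(s) ds`, where `y` solves (11) with the data of `x`
at `t₁`. Feeding these bounds for `x` and `x'` back into `f` multiplies its supremum by at most
`‖a₁‖ Y' + ‖b₁‖ Y < 1`, up to terms in the data, so `f` is controlled.

Decay comes from running the same estimate with the weight `exp (l (t - t₁))`. If the delays are at
most `τ`, a delayed argument costs a factor `exp (l τ)`. The kernels decay exponentially, so the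
weight raises `Y` and `Y'` only by an amount that vanishes as `l → 0` (`weighted_integral_le`). A
small `l > 0` therefore keeps the factor below one (`exists_weight`), and `IsKernel.decay`
concludes. Up to `t₁` a Gronwall type bound, uniform in the initial time (`IsSolution.growth`), is
enough, because `t₁` exceeds the initial time by a bounded amount.

Two gaps have to be closed. Stability of (11) bounds only `x`, and `ODEExpStable.decay` extends the
bound to `x'`. The function `fundamental` is chosen separately for each `s`, which gives no
regularity in `s`; an explicit kernel built from two solutions and their Wronskian has it, and
uniqueness identifies the two. -/

namespace DelayEq

/-! ### Carathéodory trajectories: calculus, growth, uniqueness. -/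

/-- `(x, v)` solves `x' = v`, `v' = -(a v + b x + f)` on `[t₀, ∞)` in the sense of Carathéodory. -/
structure IsTraj (a b f : ℝ → ℝ) (t₀ : ℝ) (x v : ℝ → ℝ) : Prop where
  hasDeriv : ∀ t, t₀ ≤ t → HasDerivWithinAt x (v t) (Set.Ici t₀) t
  locallyAC : ∀ T, t₀ ≤ T → AbsolutelyContinuousOnInterval v t₀ T
  equation : ∀ᵐ t, t₀ ≤ t → HasDerivAt v (-(a t * v t + b t * x t + f t)) t

theorem IsSolution.isTraj {a b a₁ b₁ g h : ℝ → ℝ} {t₀ : ℝ} {φ ψ : Set.Iio t₀ → ℝ} {x₀ x₀' : ℝ}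
    {x v : ℝ → ℝ} (H : IsSolution a b a₁ b₁ g h t₀ φ ψ x₀ x₀' x v) :
    IsTraj a b (fun t => a₁ t * v (g t) + b₁ t * x (h t)) t₀ x v where
  hasDeriv := H.hasDeriv
  locallyAC := H.locallyAC
  equation := by
    have := (ae_restrict_iff' measurableSet_Ici).1 H.equation
    filter_upwards [this] with t ht h0
    simpa only [add_assoc] using ht h0

/-- A function absolutely continuous on `[s, T]` is the integral of its almost everywhere
derivative. -/
theorem integral_of_ac {u u' : ℝ → ℝ} {s T : ℝ} (hsT : s ≤ T)
    (hu : AbsolutelyContinuousOnInterval u s T) (hd : ∀ᵐ t, s ≤ t → HasDerivAt u (u' t) t) :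
    IntervalIntegrable u' volume s T ∧ ∫ t in s..T, u' t = u T - u s := by
  have key : ∀ᵐ t, t ∈ Set.uIoc s T → deriv u t = u' t := by
    filter_upwards [hd] with t ht h1
    rw [Set.uIoc_of_le hsT] at h1
    exact (ht h1.1.le).deriv
  refine ⟨hu.intervalIntegrable_deriv.congr_ae ?_, ?_⟩
  · exact (ae_restrict_iff' measurableSet_uIoc).2 key
  · rw [← hu.integral_deriv_eq_sub]
    exact (intervalIntegral.integral_congr_ae key).symm

theorem abs_sub_le_of_ac {u u' w : ℝ → ℝ} {s T : ℝ} (hsT : s ≤ T)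
    (hu : AbsolutelyContinuousOnInterval u s T) (hd : ∀ᵐ t, s ≤ t → HasDerivAt u (u' t) t)
    (hw : ∀ᵐ t, t ∈ Set.Ioc s T → |u' t| ≤ w t) (hwi : IntervalIntegrable w volume s T) :
    |u T - u s| ≤ ∫ t in s..T, w t := by
  rw [← (integral_of_ac hsT hu hd).2, ← Real.norm_eq_abs]
  exact intervalIntegral.norm_integral_le_of_norm_le hsT hw hwi

namespace IsTraj

variable {a b f : ℝ → ℝ} {t₀ : ℝ} {x v : ℝ → ℝ}

theorem mono (H : IsTraj a b f t₀ x v) {t₁ : ℝ} (h : t₀ ≤ t₁) : IsTraj a b f t₁ x v where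
  hasDeriv t ht := (H.hasDeriv t (h.trans ht)).mono (Set.Ici_subset_Ici.2 h)
  locallyAC T hT := (H.locallyAC T (h.trans hT)).mono <| by
    rw [Set.uIcc_of_le hT, Set.uIcc_of_le (h.trans hT)]
    exact Set.Icc_subset_Icc_left h
  equation := by
    filter_upwards [H.equation] with t ht h1 using ht (h.trans h1)

theorem hasDerivAt (H : IsTraj a b f t₀ x v) {t : ℝ} (ht : t₀ < t) : HasDerivAt x (v t) t :=
  (H.hasDeriv t ht.le).hasDerivAt (Ici_mem_nhds ht)

theorem ae_hasDerivAt (H : IsTraj a b f t₀ x v) : ∀ᵐ t, t₀ ≤ t → HasDerivAt x (v t) t := by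
  have : ∀ᵐ t : ℝ, t ≠ t₀ := by simp [ae_iff, measure_singleton]
  filter_upwards [this] with t h1 h2 using H.hasDerivAt (lt_of_le_of_ne h2 (Ne.symm h1))

theorem continuousOn_fst (H : IsTraj a b f t₀ x v) : ContinuousOn x (Set.Ici t₀) :=
  fun t ht => (H.hasDeriv t ht).continuousWithinAt

theorem continuousOn_snd_Icc (H : IsTraj a b f t₀ x v) {T : ℝ} (hT : t₀ ≤ T) :
    ContinuousOn v (Set.Icc t₀ T) := by
  simpa [Set.uIcc_of_le hT] using (H.locallyAC T hT).continuousOn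

theorem continuousOn_fst_Icc (H : IsTraj a b f t₀ x v) (T : ℝ) :
    ContinuousOn x (Set.Icc t₀ T) :=
  H.continuousOn_fst.mono Set.Icc_subset_Ici_self

theorem ac_fst (H : IsTraj a b f t₀ x v) {T : ℝ} (hT : t₀ ≤ T) :
    AbsolutelyContinuousOnInterval x t₀ T := by
  obtain ⟨C, hC⟩ := (H.locallyAC T hT).exists_bound
  rw [Set.uIcc_of_le hT] at hC
  refine LipschitzOnWith.absolutelyContinuousOnInterval (K := C.toNNReal) ?_
  rw [Set.uIcc_of_le hT]
  refine (convex_Icc t₀ T).lipschitzOnWith_of_nnnorm_hasDerivWithin_le (f' := v)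
    (fun t ht => (H.hasDeriv t ht.1).mono Set.Icc_subset_Ici_self) fun t ht => ?_
  rw [← NNReal.coe_le_coe]
  exact (hC t ht).trans (Real.le_coe_toNNReal C)

/-- The bound is uniform in the initial time; `D` accounts for the initial history of an equation
with delays. -/
theorem growth (H : IsTraj a b f t₀ x v) {K D : ℝ} (hK : 0 ≤ K) (hD : 0 ≤ D)
    (ha : ∀ᵐ t, t₀ ≤ t → |a t| ≤ K) (hb : ∀ᵐ t, t₀ ≤ t → |b t| ≤ K)
    (hf : ∀ᵐ t, t₀ ≤ t → ∃ r ∈ Set.Icc t₀ t, ∃ q ∈ Set.Icc t₀ t,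
      |f t| ≤ K * (D + |v r| + |x q|)) {T : ℝ} (hT : t₀ ≤ T) :
    |x T| + |v T| ≤ 2 * (|x t₀| + |v t₀| + D) * Real.exp (2 * (3 * K + 1) * (T - t₀)) := by
  -- With `N` the maximum of `|x| + |v|` in the weight `exp (-L (t - t₀))`, integrating `x'`
  -- contributes `N / L` and integrating `v'` contributes `(3 K N + K D) / L`. This `L` makes the
  -- `N` part equal to `N / 2`, which is absorbed on the left.
  set L : ℝ := 2 * (3 * K + 1) with hL
  have hLpos : 0 < L := by positivity
  have hcont : ContinuousOn (fun t => Real.exp (-(L * (t - t₀))) * (|x t| + |v t|))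
      (Set.Icc t₀ T) := by
    have h1 := H.continuousOn_fst_Icc T
    have h2 := H.continuousOn_snd_Icc hT
    fun_prop
  obtain ⟨τ, hτ, hmax⟩ := isCompact_Icc.exists_isMaxOn (Set.nonempty_Icc.2 hT) hcont
  set N : ℝ := Real.exp (-(L * (τ - t₀))) * (|x τ| + |v τ|) with hN
  have hN0 : 0 ≤ N := by positivity
  have hbd : ∀ t ∈ Set.Icc t₀ T, |x t| + |v t| ≤ N * Real.exp (L * (t - t₀)) := by
    intro t ht
    have h1 : Real.exp (-(L * (t - t₀))) * (|x t| + |v t|) ≤ N := hmax ht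
    rw [Real.exp_neg, inv_mul_le_iff₀ (Real.exp_pos _)] at h1
    linarith
  have hNle : N ≤ 2 * (|x t₀| + |v t₀| + D) := by
    have hsub : ∀ t ∈ Set.Icc t₀ τ, t ∈ Set.Icc t₀ T := fun t ht => ⟨ht.1, ht.2.trans hτ.2⟩
    have hI : ∀ c : ℝ, IntervalIntegrable (fun t => c * Real.exp (L * (t - t₀))) volume t₀ τ :=
      fun c => Continuous.intervalIntegrable (by fun_prop) _ _
    have hint : ∀ c : ℝ, 0 ≤ c → ∫ t in t₀..τ, c * Real.exp (L * (t - t₀)) ≤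
        c / L * Real.exp (L * (τ - t₀)) := by
      intro c hc
      have hd : ∀ t ∈ Set.uIcc t₀ τ, HasDerivAt (fun t => c / L * Real.exp (L * (t - t₀)))
          (c * Real.exp (L * (t - t₀))) t := by
        intro t _
        have := ((((hasDerivAt_id t).sub_const t₀).const_mul L).exp).const_mul (c / L)
        convert! this using 1
        simp only [id]
        field_simp
      rw [intervalIntegral.integral_eq_sub_of_hasDerivAt hd (hI c)]
      have : 0 ≤ c / L * Real.exp (L * (t₀ - t₀)) := by positivity
      linarith
    have hx := abs_sub_le_of_ac hτ.1 (H.ac_fst hτ.1) H.ae_hasDerivAt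
      (w := fun t => N * Real.exp (L * (t - t₀)))
      (Filter.Eventually.of_forall fun t ht => by
        have := hbd t (hsub t ⟨ht.1.le, ht.2⟩)
        have := abs_nonneg (x t)
        linarith) (hI N)
    have hv := abs_sub_le_of_ac hτ.1 (H.locallyAC τ hτ.1) H.equation
      (w := fun t => (3 * K * N + K * D) * Real.exp (L * (t - t₀))) (by
        filter_upwards [ha, hb, hf] with t hat hbt hft ht
        obtain ⟨r, hr, q, hq, hfr⟩ := hft ht.1.le
        have hat := hat ht.1.le
        have hbt := hbt ht.1.le
        have e1 := hbd t (hsub t ⟨ht.1.le, ht.2⟩)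
        have er := hbd r (hsub r ⟨hr.1, hr.2.trans ht.2⟩)
        have eq := hbd q (hsub q ⟨hq.1, hq.2.trans ht.2⟩)
        have mr : N * Real.exp (L * (r - t₀)) ≤ N * Real.exp (L * (t - t₀)) := by
          have := hr.2; gcongr
        have mq : N * Real.exp (L * (q - t₀)) ≤ N * Real.exp (L * (t - t₀)) := by
          have := hq.2; gcongr
        have one : 1 ≤ Real.exp (L * (t - t₀)) :=
          Real.one_le_exp (mul_nonneg hLpos.le (by linarith [ht.1]))
        have hDe : D ≤ D * Real.exp (L * (t - t₀)) := le_mul_of_one_le_right hD one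
        have p1 : |a t * v t| ≤ K * |v t| := by rw [abs_mul]; gcongr
        have p2 : |b t * x t| ≤ K * |x t| := by rw [abs_mul]; gcongr
        have tri : |-(a t * v t + b t * x t + f t)| ≤ |a t * v t| + |b t * x t| + |f t| := by
          rw [abs_neg]; exact abs_add_three _ _ _
        have hxr := abs_nonneg (x r)
        have hvq := abs_nonneg (v q)
        calc |-(a t * v t + b t * x t + f t)|
            ≤ K * (|v t| + |x t| + (D + |v r| + |x q|)) := by linarith
          _ ≤ K * (3 * (N * Real.exp (L * (t - t₀))) + D * Real.exp (L * (t - t₀))) :=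
            mul_le_mul_of_nonneg_left (by linarith) hK
          _ = _ := by ring) (hI _)
    have i1 := hint N hN0
    have i2 := hint (3 * K * N + K * D) (by positivity)
    have tx : |x τ| ≤ |x t₀| + |x τ - x t₀| := by
      have := abs_add_le (x t₀) (x τ - x t₀); simpa using this
    have tv : |v τ| ≤ |v t₀| + |v τ - v t₀| := by
      have := abs_add_le (v t₀) (v τ - v t₀); simpa using this
    have hsum : N / L + (3 * K * N + K * D) / L ≤ N / 2 + D := by
      rw [← add_div, div_le_iff₀ hLpos, hL]
      nlinarith [mul_nonneg hK hD, mul_nonneg hK hN0]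
    set E := Real.exp (L * (τ - t₀)) with hE
    have hE1 : 1 ≤ E := Real.one_le_exp (mul_nonneg hLpos.le (by linarith [hτ.1]))
    have tot : |x τ| + |v τ| ≤ (|x t₀| + |v t₀|) * E + (N / 2 + D) * E := by
      have h1 : |x t₀| + |v t₀| ≤ (|x t₀| + |v t₀|) * E :=
        le_mul_of_one_le_right (by positivity) hE1
      have h2 : (N / L + (3 * K * N + K * D) / L) * E ≤ (N / 2 + D) * E := by gcongr
      linarith
    have : N ≤ |x t₀| + |v t₀| + (N / 2 + D) := by
      refine hN.le.trans ?_
      rw [Real.exp_neg, inv_mul_le_iff₀ (Real.exp_pos _)]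
      linarith
    linarith
  exact (hbd T ⟨hT, le_rfl⟩).trans (by gcongr)

theorem growth_of_homogeneous (H : IsTraj a b 0 t₀ x v) {K : ℝ} (hK : 0 ≤ K)
    (ha : ∀ᵐ t, t₀ ≤ t → |a t| ≤ K) (hb : ∀ᵐ t, t₀ ≤ t → |b t| ≤ K)
    {T : ℝ} (hT : t₀ ≤ T) :
    |x T| + |v T| ≤ 2 * (|x t₀| + |v t₀|) * Real.exp (2 * (3 * K + 1) * (T - t₀)) := by
  have := H.growth hK le_rfl ha hb (Filter.Eventually.of_forall fun t ht =>
    ⟨t, ⟨ht, le_rfl⟩, t, ⟨ht, le_rfl⟩, by simp only [Pi.zero_apply, abs_zero]; positivity⟩) hT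
  simpa using this

theorem linear_comb {y w : ℝ → ℝ} (H : IsTraj a b 0 t₀ x v) (H' : IsTraj a b 0 t₀ y w)
    (c d : ℝ) : IsTraj a b 0 t₀ (fun t => c * x t + d * y t) (fun t => c * v t + d * w t) where
  hasDeriv t ht := ((H.hasDeriv t ht).const_mul c).add ((H'.hasDeriv t ht).const_mul d)
  locallyAC T hT := ((H.locallyAC T hT).const_mul c).fun_add ((H'.locallyAC T hT).const_mul d)
  equation := by
    filter_upwards [H.equation, H'.equation] with t h1 h2 ht
    convert! ((h1 ht).const_mul c).add ((h2 ht).const_mul d) using 1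
    simp only [Pi.zero_apply]
    ring

theorem congr {y w : ℝ → ℝ} (H : IsTraj a b f t₀ x v) (hx : ∀ t, t₀ ≤ t → y t = x t)
    (hv : ∀ t, t₀ ≤ t → w t = v t) : IsTraj a b f t₀ y w where
  hasDeriv t ht := by
    rw [hv t ht]
    exact (H.hasDeriv t ht).congr hx (hx t ht)
  locallyAC T hT := by
    have h := H.locallyAC T hT
    rw [absolutelyContinuousOnInterval_iff] at h ⊢
    intro ε hε
    obtain ⟨δ, hδ, h⟩ := h ε hε
    refine ⟨δ, hδ, fun E hE hlen => lt_of_eq_of_lt (Finset.sum_congr rfl fun i hi => ?_)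
      (h E hE hlen)⟩
    have := hE.1 i hi
    rw [Set.uIcc_of_le hT] at this
    rw [hv _ this.1.1, hv _ this.2.1]
  equation := by
    -- The equation asks for a two-sided derivative, which agreement on `[t₀, ∞)` transfers only
    -- away from the null set `{t₀}`.
    have : ∀ᵐ t : ℝ, t ≠ t₀ := by simp [ae_iff, measure_singleton]
    filter_upwards [H.equation, this] with t h1 h2 ht
    rw [hv t ht, hx t ht]
    refine (h1 ht).congr_of_eventuallyEq ?_
    filter_upwards [Ici_mem_nhds (lt_of_le_of_ne ht (Ne.symm h2))] with s hs using hv s hs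

/-- The difference is a trajectory with zero data, and the growth bound is proportional to the data.
-/
theorem eq_of_initial {y w : ℝ → ℝ} (H : IsTraj a b 0 t₀ x v) (H' : IsTraj a b 0 t₀ y w)
    {K : ℝ} (hK : 0 ≤ K) (ha : ∀ᵐ t, t₀ ≤ t → |a t| ≤ K) (hb : ∀ᵐ t, t₀ ≤ t → |b t| ≤ K)
    (hx : x t₀ = y t₀) (hv : v t₀ = w t₀) {t : ℝ} (ht : t₀ ≤ t) : x t = y t := by
  have := (H.linear_comb H' 1 (-1)).growth_of_homogeneous hK ha hb ht
  simp only [hx, hv, one_mul, neg_mul, add_neg_cancel, abs_zero, add_zero, mul_zero,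
    zero_mul] at this
  have h1 := abs_nonneg (v t + -w t)
  have h2 : |x t + -y t| = 0 := le_antisymm (by linarith) (abs_nonneg _)
  linarith [abs_eq_zero.1 h2]

end IsTraj

/-! ### Existence for the homogeneous equation. -/

/-- Source of the contraction: in the weight `exp (-L t)`, integration has norm at most `1 / L`. -/
theorem abs_exp_mul_integral_le {F : ℝ → ℝ} {L C τ : ℝ} (hL : 0 < L) (hC : 0 ≤ C) (hτ : 0 ≤ τ)
    (hF : ∀ s, |F s| ≤ C * Real.exp (L * s)) :
    |Real.exp (-(L * τ)) * ∫ s in (0 : ℝ)..τ, F s| ≤ C / L := by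
  have hI : IntervalIntegrable (fun s => C * Real.exp (L * s)) volume 0 τ :=
    Continuous.intervalIntegrable (by fun_prop) _ _
  have h1 : |∫ s in (0 : ℝ)..τ, F s| ≤ ∫ s in (0 : ℝ)..τ, C * Real.exp (L * s) := by
    rw [← Real.norm_eq_abs]
    exact intervalIntegral.norm_integral_le_of_norm_le hτ
      (Filter.Eventually.of_forall fun s _ => hF s) hI
  have hd : ∀ t ∈ Set.uIcc 0 τ, HasDerivAt (fun t => C / L * Real.exp (L * t))
      (C * Real.exp (L * t)) t := by
    intro t _
    have := (((hasDerivAt_id t).const_mul L).exp).const_mul (C / L)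
    convert! this using 1
    simp only [id]
    field_simp
  rw [intervalIntegral.integral_eq_sub_of_hasDerivAt hd hI] at h1
  have h2 : 0 ≤ C / L * Real.exp (L * 0) := by positivity
  rw [abs_mul, abs_of_pos (Real.exp_pos _), Real.exp_neg, inv_mul_le_iff₀ (Real.exp_pos _)]
  linarith

theorem intervalIntegrable_of_measurable_of_le {a : ℝ → ℝ} (ha : Measurable a) {K : ℝ}
    (hK : ∀ t, |a t| ≤ K) (s t : ℝ) : IntervalIntegrable a volume s t :=
  (intervalIntegrable_const (c := K)).mono_fun' ha.aestronglyMeasurable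
    (Filter.Eventually.of_forall hK)

open scoped BoundedContinuousFunction in
/-- The Volterra form of the homogeneous equation has a solution: a fixed point in the space of
continuous functions weighted by `exp (-L t)`. -/
theorem exists_volterra_solution {a b : ℝ → ℝ} (ha : Measurable a) (hb : Measurable b) {K : ℝ}
    (hK : 0 ≤ K) (haK : ∀ t, |a t| ≤ K) (hbK : ∀ t, |b t| ≤ K) (α β : ℝ) :
    ∃ x v : ℝ → ℝ, Continuous x ∧ Continuous v ∧
      (∀ t, 0 ≤ t → x t = α + ∫ s in (0 : ℝ)..t, v s) ∧
      (∀ t, 0 ≤ t → v t = β - ∫ s in (0 : ℝ)..t, (a s * v s + b s * x s)) := by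
  -- The unknown is `w = exp (-L t) (x, v)`. The right-hand sides `F₁` and `F₂` are Lipschitz with
  -- constants `1` and `2 K`, so dividing by this `L` gives contraction factor `1 / 2`.
  set L : ℝ := 2 * (2 * K + 1) with hL
  have hLpos : 0 < L := by positivity
  let F₁ : (ℝ →ᵇ ℝ × ℝ) → ℝ → ℝ := fun w s => Real.exp (L * s) * (w s).2
  let F₂ : (ℝ →ᵇ ℝ × ℝ) → ℝ → ℝ := fun w s =>
    -(a s * (Real.exp (L * s) * (w s).2) + b s * (Real.exp (L * s) * (w s).1))
  have hF₁i : ∀ w s t, IntervalIntegrable (F₁ w) volume s t := fun w s t =>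
    Continuous.intervalIntegrable (by fun_prop) _ _
  have hF₂i : ∀ w s t, IntervalIntegrable (F₂ w) volume s t := fun w s t =>
    (((intervalIntegrable_of_measurable_of_le ha haK s t).mul_continuousOn
      (Continuous.continuousOn (by fun_prop))).add
    ((intervalIntegrable_of_measurable_of_le hb hbK s t).mul_continuousOn
      (Continuous.continuousOn (by fun_prop)))).neg
  have hF₁b : ∀ (w w' : ℝ →ᵇ ℝ × ℝ) s,
      |F₁ w s - F₁ w' s| ≤ (2 * K + 1) * dist w w' * Real.exp (L * s) := by
    intro w w' s
    have h2 : |(w s).2 - (w' s).2| ≤ dist w w' :=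
      (norm_snd_le (w s - w' s)).trans
        ((dist_eq_norm _ _).symm.le.trans (BoundedContinuousFunction.dist_coe_le_dist s))
    have h0 : 0 ≤ 2 * K * dist w w' := by positivity
    calc |F₁ w s - F₁ w' s| = |(w s).2 - (w' s).2| * Real.exp (L * s) := by
          simp only [F₁]; rw [← mul_sub, abs_mul, abs_of_pos (Real.exp_pos _), mul_comm]
      _ ≤ _ := by gcongr; linarith
  have hF₂b : ∀ (w w' : ℝ →ᵇ ℝ × ℝ) s,
      |F₂ w s - F₂ w' s| ≤ (2 * K + 1) * dist w w' * Real.exp (L * s) := by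
    intro w w' s
    have h2 : |(w s).2 - (w' s).2| ≤ dist w w' :=
      (norm_snd_le (w s - w' s)).trans
        ((dist_eq_norm _ _).symm.le.trans (BoundedContinuousFunction.dist_coe_le_dist s))
    have h1 : |(w s).1 - (w' s).1| ≤ dist w w' :=
      (norm_fst_le (w s - w' s)).trans
        ((dist_eq_norm _ _).symm.le.trans (BoundedContinuousFunction.dist_coe_le_dist s))
    have h0 : 0 ≤ dist w w' := dist_nonneg
    calc |F₂ w s - F₂ w' s|
        = |a s * ((w s).2 - (w' s).2) + b s * ((w s).1 - (w' s).1)| * Real.exp (L * s) := by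
          rw [← abs_of_pos (Real.exp_pos (L * s)), ← abs_mul, ← abs_neg]
          simp only [F₂]
          congr 1
          ring
      _ ≤ (|a s| * |(w s).2 - (w' s).2| + |b s| * |(w s).1 - (w' s).1|) * Real.exp (L * s) := by
          rw [← abs_mul, ← abs_mul]
          gcongr
          exact abs_add_le _ _
      _ ≤ (K * dist w w' + K * dist w w') * Real.exp (L * s) := by
          gcongr
          · exact haK s
          · exact hbK s
      _ ≤ _ := by gcongr; linarith
  have hint : ∀ F : (ℝ →ᵇ ℝ × ℝ) → ℝ → ℝ, (∀ w s t, IntervalIntegrable (F w) volume s t) →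
      (∀ w w' s, |F w s - F w' s| ≤ (2 * K + 1) * dist w w' * Real.exp (L * s)) →
      ∀ (c : ℝ) w w' τ, 0 ≤ τ →
      |Real.exp (-(L * τ)) * (c + ∫ s in (0 : ℝ)..τ, F w s) -
        Real.exp (-(L * τ)) * (c + ∫ s in (0 : ℝ)..τ, F w' s)| ≤ 1 / 2 * dist w w' := by
    intro F hFi hFb c w w' τ hτ
    have := abs_exp_mul_integral_le (F := fun s => F w s - F w' s) hLpos
      (C := (2 * K + 1) * dist w w') (by positivity) hτ (hFb w w')
    rw [intervalIntegral.integral_sub (hFi w _ _) (hFi w' _ _)] at this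
    calc _ = |Real.exp (-(L * τ)) *
          ((∫ s in (0 : ℝ)..τ, F w s) - ∫ s in (0 : ℝ)..τ, F w' s)| := by
            congr 1; ring
      _ ≤ _ := this
      _ = _ := by rw [hL]; field_simp
  -- Replacing `t` by `max t 0` freezes the values for negative times, where the weight would be
  -- unbounded, so that the image is bounded on all of `ℝ`.
  let G : (ℝ →ᵇ ℝ × ℝ) → ℝ → ℝ × ℝ := fun w t =>
    (Real.exp (-(L * max t 0)) * (α + ∫ s in (0 : ℝ)..max t 0, F₁ w s),
     Real.exp (-(L * max t 0)) * (β + ∫ s in (0 : ℝ)..max t 0, F₂ w s))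
  have hGd : ∀ w w' t, ‖G w t - G w' t‖ ≤ 1 / 2 * dist w w' := fun w w' t =>
    max_le (hint F₁ hF₁i hF₁b α w w' _ (le_max_right _ _))
      (hint F₂ hF₂i hF₂b β w w' _ (le_max_right _ _))
  have hGc : ∀ w, Continuous (G w) := by
    intro w
    have c1 := (intervalIntegral.continuous_primitive (hF₁i w) 0).comp
      (continuous_id.max continuous_const : Continuous fun t : ℝ => max t 0)
    have c2 := (intervalIntegral.continuous_primitive (hF₂i w) 0).comp
      (continuous_id.max continuous_const : Continuous fun t : ℝ => max t 0)
    have e : Continuous fun t : ℝ => Real.exp (-(L * max t 0)) := by fun_prop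
    exact (e.mul (continuous_const.add c1)).prodMk (e.mul (continuous_const.add c2))
  have hG0 : ∀ t, ‖G 0 t‖ ≤ max |α| |β| := by
    intro t
    have e : Real.exp (-(L * max t 0)) ≤ 1 := by
      rw [Real.exp_le_one_iff, neg_nonpos]
      exact mul_nonneg hLpos.le (le_max_right _ _)
    have h0 := Real.exp_pos (-(L * max t 0))
    have h1 : ∀ c : ℝ, |Real.exp (-(L * max t 0)) * c| ≤ |c| := by
      intro c
      rw [abs_mul, abs_of_pos h0]
      exact mul_le_of_le_one_left (abs_nonneg _) e
    have : G 0 t = (Real.exp (-(L * max t 0)) * α, Real.exp (-(L * max t 0)) * β) := by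
      simp [G, F₁, F₂]
    rw [this]
    exact max_le_max (h1 α) (h1 β)
  have hGb : ∀ w t, ‖G w t‖ ≤ max |α| |β| + 1 / 2 * dist w 0 := by
    intro w t
    have := norm_add_le (G 0 t) (G w t - G 0 t)
    rw [add_sub_cancel] at this
    exact this.trans (add_le_add (hG0 t) (hGd w 0 t))
  let T : (ℝ →ᵇ ℝ × ℝ) → (ℝ →ᵇ ℝ × ℝ) := fun w =>
    BoundedContinuousFunction.ofNormedAddCommGroup (G w) (hGc w) _ (hGb w)
  have hT : ContractingWith (1 / 2) T := by
    refine ⟨by rw [← NNReal.coe_lt_coe]; norm_num, LipschitzWith.of_dist_le_mul fun w w' => ?_⟩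
    have hc : ((1 / 2 : NNReal) : ℝ) = 1 / 2 := by norm_num
    rw [hc, BoundedContinuousFunction.dist_le (by positivity)]
    intro t
    rw [dist_eq_norm]
    exact hGd w w' t
  obtain ⟨w, hw, -⟩ := hT.exists_fixedPoint 0 (edist_ne_top _ _)
  have hwt : ∀ t, 0 ≤ t → w t = G w t := fun t _ =>
    (congrArg (fun u : ℝ →ᵇ ℝ × ℝ => u t) hw).symm
  refine ⟨fun t => Real.exp (L * t) * (w t).1, fun t => Real.exp (L * t) * (w t).2,
    by fun_prop, by fun_prop, fun t ht => ?_, fun t ht => ?_⟩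
  · have h1 : (w t).1 = Real.exp (-(L * t)) * (α + ∫ s in (0 : ℝ)..t, F₁ w s) := by
      rw [hwt t ht]; simp only [G, max_eq_left ht]
    simp only [h1]
    rw [← mul_assoc, ← Real.exp_add, add_neg_cancel, Real.exp_zero, one_mul]
  · have h1 : (w t).2 = Real.exp (-(L * t)) * (β + ∫ s in (0 : ℝ)..t, F₂ w s) := by
      rw [hwt t ht]; simp only [G, max_eq_left ht]
    simp only [h1]
    rw [← mul_assoc, ← Real.exp_add, add_neg_cancel, Real.exp_zero, one_mul]
    simp only [F₂]
    rw [intervalIntegral.integral_neg, sub_eq_add_neg]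

/-- Carathéodory existence on `[0, ∞)` for the homogeneous equation. -/
theorem exists_traj_of_measurable {a b : ℝ → ℝ} (ha : Measurable a) (hb : Measurable b) {K : ℝ}
    (hK : 0 ≤ K) (haK : ∀ t, |a t| ≤ K) (hbK : ∀ t, |b t| ≤ K) (α β : ℝ) :
    ∃ x v : ℝ → ℝ, IsTraj a b 0 0 x v ∧ x 0 = α ∧ v 0 = β := by
  obtain ⟨x, v, hxc, hvc, hx, hv⟩ := exists_volterra_solution ha hb hK haK hbK α β
  set F : ℝ → ℝ := fun s => a s * v s + b s * x s with hF
  have hFi : ∀ s t, IntervalIntegrable F volume s t := fun s t =>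
    ((intervalIntegrable_of_measurable_of_le ha haK s t).mul_continuousOn hvc.continuousOn).add
    ((intervalIntegrable_of_measurable_of_le hb hbK s t).mul_continuousOn hxc.continuousOn)
  have hFl : LocallyIntegrable F volume := by
    rw [locallyIntegrable_iff]
    intro k hk
    obtain ⟨R, hR⟩ := hk.isBounded.subset_closedBall 0
    rw [Real.closedBall_eq_Icc] at hR
    have h1 : -|R| ≤ |R| := by linarith [abs_nonneg R]
    refine ((intervalIntegrable_iff_integrableOn_Icc_of_le h1).1 (hFi _ _)).mono_set
      (hR.trans (Set.Icc_subset_Icc ?_ ?_)) <;> linarith [le_abs_self R]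
  -- The velocity is written so that it is literally `v` for `t ≥ 0`, yet equals the primitive of
  -- `-F` everywhere; the latter form is absolutely continuous and has a two-sided derivative almost
  -- everywhere.
  have key : IsTraj a b 0 0 (fun t => α + ∫ s in (0 : ℝ)..t, v s)
      (fun t => if 0 ≤ t then v t else β - ∫ s in (0 : ℝ)..t, F s) := by
    have hv' : (fun t => if 0 ≤ t then v t else β - ∫ s in (0 : ℝ)..t, F s) =
        fun t => β - ∫ s in (0 : ℝ)..t, F s := by
      funext t
      split_ifs with h
      · exact hv t h
      · rfl
    refine ⟨fun t ht => ?_, fun T hT => ?_, ?_⟩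
    · rw [if_pos ht]
      exact ((hvc.integral_hasStrictDerivAt 0 t).hasDerivAt.const_add α).hasDerivWithinAt
    · rw [hv']
      have h1 := (hFi 0 T).absolutelyContinuousOnInterval_intervalIntegral (c := 0) (by simp)
      have h2 : AbsolutelyContinuousOnInterval (fun _ : ℝ => β) 0 T :=
        (LipschitzWith.const β).lipschitzOnWith.absolutelyContinuousOnInterval
      exact h2.fun_sub h1
    · filter_upwards [LocallyIntegrable.ae_hasDerivAt_integral hFl] with t h1 ht
      rw [if_pos ht, ← hx t ht, hv']
      simpa [hF] using (h1 0).const_sub β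
  refine ⟨x, v, key.congr (fun t ht => hx t ht) (fun t ht => (if_pos ht).symm), ?_, ?_⟩
  · simpa using hx 0 le_rfl
  · simpa using hv 0 le_rfl

theorem IsTraj.congr_coeff {a b a' b' f : ℝ → ℝ} {t₀ : ℝ} {x v : ℝ → ℝ}
    (H : IsTraj a b f t₀ x v) (ha : ∀ᵐ t, t₀ ≤ t → a' t = a t)
    (hb : ∀ᵐ t, t₀ ≤ t → b' t = b t) : IsTraj a' b' f t₀ x v where
  hasDeriv := H.hasDeriv
  locallyAC := H.locallyAC
  equation := by
    filter_upwards [H.equation, ha, hb] with t h1 h2 h3 ht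
    rw [h2 ht, h3 ht]
    exact h1 ht

theorem IsCoeff.eLpNorm_ne_top {a : ℝ → ℝ} (ha : IsCoeff a) {t₀ : ℝ} (ht₀ : 0 ≤ t₀) :
    eLpNorm a ∞ (volume.restrict (Set.Ici t₀)) ≠ ∞ :=
  ((eLpNorm_mono_measure a (Measure.restrict_mono (Set.Ici_subset_Ici.2 ht₀) le_rfl)).trans_lt
    ha.2).ne

theorem IsCoeff.ae_abs_le {a : ℝ → ℝ} (ha : IsCoeff a) {t₀ : ℝ} (ht₀ : 0 ≤ t₀) :
    ∀ᵐ t, t₀ ≤ t → |a t| ≤ (eLpNorm a ∞ (volume.restrict (Set.Ici t₀))).toReal := by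
  have h1 := ae_le_eLpNormEssSup (f := a) (μ := volume.restrict (Set.Ici t₀))
  rw [ae_restrict_iff' measurableSet_Ici] at h1
  filter_upwards [h1] with t ht h0
  have h2 := ht h0
  rw [← eLpNorm_exponent_top] at h2
  simpa using ENNReal.toReal_mono (ha.eLpNorm_ne_top ht₀) h2

theorem IsCoeff.exists_bound {a : ℝ → ℝ} (ha : IsCoeff a) :
    ∃ K, 0 ≤ K ∧ ∀ᵐ t, (0 : ℝ) ≤ t → |a t| ≤ K :=
  ⟨_, ENNReal.toReal_nonneg, ha.ae_abs_le le_rfl⟩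

/-- The fixed point argument wants coefficients that are measurable and bounded at every point.
Truncating a measurable representative to `[-K, K]` alters it on `[0, ∞)` only in a null set. -/
theorem IsCoeff.exists_measurable {a : ℝ → ℝ} (ha : IsCoeff a) {K : ℝ} (hK : 0 ≤ K)
    (haK : ∀ᵐ t, (0 : ℝ) ≤ t → |a t| ≤ K) :
    ∃ a' : ℝ → ℝ, Measurable a' ∧ (∀ t, |a' t| ≤ K) ∧ ∀ᵐ t, (0 : ℝ) ≤ t → a t = a' t := by
  have hm := ha.1.aemeasurable
  refine ⟨fun t => max (-K) (min (hm.mk a t) K),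
    measurable_const.max (hm.measurable_mk.min measurable_const), fun t => ?_, ?_⟩
  · rw [abs_le]
    exact ⟨le_max_left _ _, max_le (by linarith) (min_le_right _ _)⟩
  · have h1 := (ae_restrict_iff' measurableSet_Ici).1 hm.ae_eq_mk
    filter_upwards [h1, haK] with t h2 h3 ht
    have h4 := abs_le.1 (h3 ht)
    rw [← h2 ht, min_eq_left h4.2, max_eq_right h4.1]

theorem exists_traj {a b : ℝ → ℝ} (ha : IsCoeff a) (hb : IsCoeff b) (α β : ℝ) :
    ∃ x v : ℝ → ℝ, IsTraj a b 0 0 x v ∧ x 0 = α ∧ v 0 = β := by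
  obtain ⟨A, hA, haA⟩ := ha.exists_bound
  obtain ⟨B, hB, hbB⟩ := hb.exists_bound
  obtain ⟨a', ha'm, ha', haa'⟩ := ha.exists_measurable hA haA
  obtain ⟨b', hb'm, hb', hbb'⟩ := hb.exists_measurable hB hbB
  obtain ⟨x, v, H, hx, hv⟩ := exists_traj_of_measurable ha'm hb'm (le_max_of_le_left hA)
    (fun t => (ha' t).trans (le_max_left A B)) (fun t => (hb' t).trans (le_max_right A B)) α β
  exact ⟨x, v, H.congr_coeff haa' hbb', hx, hv⟩

/-! ### Fundamental systems and variation of constants. -/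

/-- `x₁, x₂` solve the homogeneous equation on `[0, ∞)` and `p` is the inverse of their
Wronskian. -/
structure IsFundamentalSystem (a b x₁ v₁ x₂ v₂ p : ℝ → ℝ) : Prop where
  traj₁ : IsTraj a b 0 0 x₁ v₁
  traj₂ : IsTraj a b 0 0 x₂ v₂
  ac : ∀ T, 0 ≤ T → AbsolutelyContinuousOnInterval p 0 T
  hasDerivAt : ∀ᵐ t, (0 : ℝ) ≤ t → HasDerivAt p (a t * p t) t
  wronskian : ∀ t, 0 ≤ t → p t * (x₁ t * v₂ t - v₁ t * x₂ t) = 1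

theorem exists_fundamentalSystem {a b : ℝ → ℝ} (ha : IsCoeff a) (hb : IsCoeff b) :
    ∃ x₁ v₁ x₂ v₂ p, IsFundamentalSystem a b x₁ v₁ x₂ v₂ p := by
  obtain ⟨x₁, v₁, H₁, hx₁, hv₁⟩ := exists_traj ha hb 1 0
  obtain ⟨x₂, v₂, H₂, hx₂, hv₂⟩ := exists_traj ha hb 0 1
  -- With coefficients `-a` and `0` the equation reads `v' = a v`, so its velocity component is the
  -- desired `p`. The Wronskian `W` satisfies `W' = -a W`, hence `p W` is constant.
  have ha' : IsCoeff (-a) := MemLp.neg ha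
  have h0 : IsCoeff 0 := MemLp.zero
  obtain ⟨q, p, H, -, hp⟩ := exists_traj ha' h0 0 1
  have hd : ∀ᵐ t, (0 : ℝ) ≤ t → HasDerivAt p (a t * p t) t := by
    filter_upwards [H.equation] with t h ht
    simpa using h ht
  refine ⟨x₁, v₁, x₂, v₂, p, H₁, H₂, H.locallyAC, hd, fun T hT => ?_⟩
  have hac : AbsolutelyContinuousOnInterval (fun t => p t * (x₁ t * v₂ t - v₁ t * x₂ t)) 0 T :=
    (H.locallyAC T hT).fun_mul (((H₁.ac_fst hT).fun_mul (H₂.locallyAC T hT)).fun_sub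
      ((H₁.locallyAC T hT).fun_mul (H₂.ac_fst hT)))
  have hder : ∀ᵐ t, (0 : ℝ) ≤ t →
      HasDerivAt (fun t => p t * (x₁ t * v₂ t - v₁ t * x₂ t)) ((fun _ => (0 : ℝ)) t) t := by
    filter_upwards [hd, H₁.equation, H₂.equation, H₁.ae_hasDerivAt, H₂.ae_hasDerivAt]
      with t e e₁ e₂ d₁ d₂ ht
    convert! (e ht).mul (((d₁ ht).mul (e₂ ht)).sub ((e₁ ht).mul (d₂ ht))) using 1
    simp only [Pi.zero_apply, Pi.sub_apply, Pi.mul_apply]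
    ring
  have := (integral_of_ac hT hac hder).2
  simp only [intervalIntegral.integral_zero, hp, hx₁, hv₁, hx₂, hv₂] at this
  linarith

/-- `k` is the Cauchy kernel of the homogeneous equation and `k'` its derivative in the first
variable; `representation` is the variation of constants formula. -/
structure IsKernel (a b : ℝ → ℝ) (k k' : ℝ → ℝ → ℝ) : Prop where
  traj : ∀ s, 0 ≤ s → IsTraj a b 0 s (fun t => k t s) (fun t => k' t s)
  diag : ∀ s, 0 ≤ s → k s s = 0
  diag_deriv : ∀ s, 0 ≤ s → k' s s = 1
  continuousOn : ∀ t, 0 ≤ t → ContinuousOn (k t) (Set.Icc 0 t)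
  continuousOn_deriv : ∀ t, 0 ≤ t → ContinuousOn (k' t) (Set.Icc 0 t)
  representation : ∀ (f : ℝ → ℝ) (t₁ : ℝ) (x v : ℝ → ℝ), 0 ≤ t₁ → IsTraj a b f t₁ x v →
    ∃ y w, IsTraj a b 0 t₁ y w ∧ y t₁ = x t₁ ∧ w t₁ = v t₁ ∧ ∀ t, t₁ ≤ t →
      x t = y t - (∫ s in t₁..t, k t s * f s) ∧ v t = w t - ∫ s in t₁..t, k' t s * f s

namespace IsFundamentalSystem

variable {a b x₁ v₁ x₂ v₂ p : ℝ → ℝ}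

/-- Cramer's rule writes `(x, v)` in the basis `(x₁, v₁)`, `(x₂, v₂)` with coefficients `c₁`, `c₂`.
Their derivatives are `p f x₂` and `-p f x₁`; freezing them at `t₁` gives `y`, and integrating them
gives the kernel term. Integrability of these products follows from absolute continuity of `c₁`,
`c₂`. -/
theorem representation (S : IsFundamentalSystem a b x₁ v₁ x₂ v₂ p) {f : ℝ → ℝ} {t₁ : ℝ}
    {x v : ℝ → ℝ} (ht₁ : 0 ≤ t₁) (H : IsTraj a b f t₁ x v) :
    ∃ y w, IsTraj a b 0 t₁ y w ∧ y t₁ = x t₁ ∧ w t₁ = v t₁ ∧ ∀ t, t₁ ≤ t →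
      x t = y t - (∫ s in t₁..t, p s * (x₁ s * x₂ t - x₂ s * x₁ t) * f s) ∧
      v t = w t - ∫ s in t₁..t, p s * (x₁ s * v₂ t - x₂ s * v₁ t) * f s := by
  have H₁ := S.traj₁.mono ht₁
  have H₂ := S.traj₂.mono ht₁
  set c₁ : ℝ → ℝ := fun t => p t * (x t * v₂ t - v t * x₂ t) with hc₁
  set c₂ : ℝ → ℝ := fun t => p t * (x₁ t * v t - v₁ t * x t) with hc₂
  have hx : ∀ t, 0 ≤ t → c₁ t * x₁ t + c₂ t * x₂ t = x t := fun t ht => by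
    linear_combination (x t) * S.wronskian t ht
  have hv : ∀ t, 0 ≤ t → c₁ t * v₁ t + c₂ t * v₂ t = v t := fun t ht => by
    linear_combination (v t) * S.wronskian t ht
  refine ⟨_, _, H₁.linear_comb H₂ (c₁ t₁) (c₂ t₁), hx t₁ ht₁, hv t₁ ht₁, fun t ht => ?_⟩
  have hp : AbsolutelyContinuousOnInterval p t₁ t := (S.ac t (ht₁.trans ht)).mono <| by
    rw [Set.uIcc_of_le ht, Set.uIcc_of_le (ht₁.trans ht)]
    exact Set.Icc_subset_Icc_left ht₁
  have hd := S.hasDerivAt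
  have i₁ := integral_of_ac (u := c₁) (u' := fun s => p s * f s * x₂ s) ht
    (hp.fun_mul (((H.ac_fst ht).fun_mul (H₂.locallyAC t ht)).fun_sub
      ((H.locallyAC t ht).fun_mul (H₂.ac_fst ht)))) (by
    filter_upwards [hd, H.equation, H₂.equation, H.ae_hasDerivAt, H₂.ae_hasDerivAt]
      with s e e₁ e₂ d₁ d₂ hs
    convert! (e (ht₁.trans hs)).mul (((d₁ hs).mul (e₂ hs)).sub ((e₁ hs).mul (d₂ hs))) using 1
    simp only [Pi.zero_apply, Pi.sub_apply, Pi.mul_apply]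
    ring)
  have i₂ := integral_of_ac (u := c₂) (u' := fun s => -(p s * f s * x₁ s)) ht
    (hp.fun_mul (((H₁.ac_fst ht).fun_mul (H.locallyAC t ht)).fun_sub
      ((H₁.locallyAC t ht).fun_mul (H.ac_fst ht)))) (by
    filter_upwards [hd, H₁.equation, H.equation, H₁.ae_hasDerivAt, H.ae_hasDerivAt]
      with s e e₁ e₂ d₁ d₂ hs
    convert! (e (ht₁.trans hs)).mul (((d₁ hs).mul (e₂ hs)).sub ((e₁ hs).mul (d₂ hs))) using 1
    simp only [Pi.zero_apply, Pi.sub_apply, Pi.mul_apply]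
    ring)
  have comb : ∀ A B : ℝ, ∫ s in t₁..t, p s * (x₁ s * B - x₂ s * A) * f s =
      -(A * (c₁ t - c₁ t₁) + B * (c₂ t - c₂ t₁)) := by
    intro A B
    rw [← i₁.2, ← i₂.2, ← intervalIntegral.integral_const_mul,
      ← intervalIntegral.integral_const_mul,
      ← intervalIntegral.integral_add (i₁.1.const_mul A) (i₂.1.const_mul B),
      ← intervalIntegral.integral_neg]
    congr 1
    funext s
    ring
  constructor
  · rw [comb]
    linear_combination -hx t (ht₁.trans ht)
  · rw [comb]
    linear_combination -hv t (ht₁.trans ht)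

theorem isKernel (S : IsFundamentalSystem a b x₁ v₁ x₂ v₂ p) :
    IsKernel a b (fun t s => p s * (x₁ s * x₂ t - x₂ s * x₁ t))
      (fun t s => p s * (x₁ s * v₂ t - x₂ s * v₁ t)) where
  traj s hs := by
    refine ((S.traj₁.mono hs).linear_comb (S.traj₂.mono hs) (-(p s * x₂ s)) (p s * x₁ s)).congr
      (fun t _ => ?_) (fun t _ => ?_) <;> ring
  diag s _ := by ring
  diag_deriv s hs := by
    linear_combination S.wronskian s hs
  continuousOn t ht := by
    have h1 := S.traj₁.continuousOn_fst_Icc t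
    have h2 := S.traj₂.continuousOn_fst_Icc t
    have h3 := (S.ac t ht).continuousOn
    rw [Set.uIcc_of_le ht] at h3
    fun_prop
  continuousOn_deriv t ht := by
    have h1 := S.traj₁.continuousOn_fst_Icc t
    have h2 := S.traj₂.continuousOn_fst_Icc t
    have h3 := (S.ac t ht).continuousOn
    rw [Set.uIcc_of_le ht] at h3
    fun_prop
  representation _ _ _ _ ht₁ H := S.representation ht₁ H

end IsFundamentalSystem

/-! ### Identification with `Y` and decay of the derivative. -/

theorem IsTraj.isSolution {a b : ℝ → ℝ} {s : ℝ} {x v : ℝ → ℝ} (H : IsTraj a b 0 s x v) :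
    IsSolution a b 0 0 id id s 0 0 (x s) (v s)
      (fun t => if t < s then 0 else x t) (fun t => if t < s then 0 else v t) := by
  have H' := H.congr (y := fun t => if t < s then 0 else x t)
    (w := fun t => if t < s then 0 else v t)
    (fun t ht => if_neg ht.not_gt) (fun t ht => if_neg ht.not_gt)
  refine ⟨fun r => if_pos r.2, fun r => if_pos r.2, if_neg (lt_irrefl s), if_neg (lt_irrefl s),
    H'.hasDeriv, H'.locallyAC, ?_⟩
  rw [ae_restrict_iff' measurableSet_Ici]
  filter_upwards [H'.equation] with t h ht
  simpa using h ht

section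

variable {a b : ℝ → ℝ} {k k' : ℝ → ℝ → ℝ} {K : ℝ}

theorem IsKernel.fundamental_eq (hk : IsKernel a b k k') (hK : 0 ≤ K)
    (ha : ∀ᵐ t, (0 : ℝ) ≤ t → |a t| ≤ K) (hb : ∀ᵐ t, (0 : ℝ) ≤ t → |b t| ≤ K) {s t : ℝ}
    (hs : 0 ≤ s) (hst : s ≤ t) : fundamental a b t s = k t s := by
  have Hk := hk.traj s hs
  have H : ∃ x v : ℝ → ℝ, IsSolution a b 0 0 id id s 0 0 0 1 x v := by
    have := Hk.isSolution
    rw [hk.diag s hs, hk.diag_deriv s hs] at this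
    exact ⟨_, _, this⟩
  rw [fundamental, dif_pos H]
  obtain ⟨v, hv⟩ := H.choose_spec
  have Hv : IsTraj a b 0 s H.choose v := by
    convert hv.isTraj using 1
    funext t
    simp
  refine Hv.eq_of_initial Hk hK ?_ ?_ ?_ ?_ hst
  · filter_upwards [ha] with t h ht using h (hs.trans ht)
  · filter_upwards [hb] with t h ht using h (hs.trans ht)
  · rw [hv.initial, hk.diag s hs]
  · rw [hv.initial_deriv, hk.diag_deriv s hs]

/-- The inequality `s < t` is strict because `Y(·, s)` vanishes before `s` and has a corner at `t =
s`. -/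
theorem IsKernel.deriv_fundamental_eq (hk : IsKernel a b k k') (hK : 0 ≤ K)
    (ha : ∀ᵐ t, (0 : ℝ) ≤ t → |a t| ≤ K) (hb : ∀ᵐ t, (0 : ℝ) ≤ t → |b t| ≤ K) {s t : ℝ}
    (hs : 0 ≤ s) (hst : s < t) : deriv (fun τ => fundamental a b τ s) t = k' t s := by
  refine HasDerivAt.deriv (((hk.traj s hs).hasDerivAt hst).congr_of_eventuallyEq ?_)
  filter_upwards [Ici_mem_nhds hst] with τ hτ using hk.fundamental_eq hK ha hb hs hτ

/-- Exponential stability of the ordinary differential equation controls the derivative of the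
solutions as well. -/
theorem ODEExpStable.decay (h : ODEExpStable a b) (hK : 0 ≤ K)
    (ha : ∀ᵐ t, (0 : ℝ) ≤ t → |a t| ≤ K) (hb : ∀ᵐ t, (0 : ℝ) ≤ t → |b t| ≤ K) :
    ∃ M > 0, ∃ μ > 0, ∀ s x v, 0 ≤ s → IsTraj a b 0 s x v → ∀ t, s ≤ t →
      |x t| ≤ M * Real.exp (-(μ * (t - s))) * (|x s| + |v s|) ∧
      |v t| ≤ M * Real.exp (-(μ * (t - s))) * (|x s| + |v s|) := by
  obtain ⟨M, hM, μ, hμ, h⟩ := h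
  have hx : ∀ s x v, 0 ≤ s → IsTraj a b 0 s x v → ∀ t, s ≤ t →
      |x t| ≤ M * Real.exp (-(μ * (t - s))) * (|x s| + |v s|) := by
    intro s x v hs H t ht
    have := h s hs 0 0 measurable_const measurable_const ⟨0, by simp⟩ ⟨0, by simp⟩ _ _ _ _
      H.isSolution t ht
    simpa [ht.not_gt] using this
  set L : ℝ := 2 * (3 * K + 1) with hL
  have hLpos : 0 < L := by positivity
  have hgr : ∀ s x v, 0 ≤ s → IsTraj a b 0 s x v → ∀ t, s ≤ t → t ≤ s + 1 →
      |v t| ≤ 2 * (|x s| + |v s|) * Real.exp L := by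
    intro s x v hs H t ht ht1
    have h1 := H.growth_of_homogeneous hK
      (by filter_upwards [ha] with t h ht using h (hs.trans ht))
      (by filter_upwards [hb] with t h ht using h (hs.trans ht)) ht
    have h2 : Real.exp (L * (t - s)) ≤ Real.exp L := by
      gcongr
      nlinarith
    have h3 : 2 * (|x s| + |v s|) * Real.exp (L * (t - s)) ≤
        2 * (|x s| + |v s|) * Real.exp L := by gcongr
    linarith [abs_nonneg (x t)]
  -- The summands serve, in order, `x` itself, `v` on the first unit of time, and `v` afterwards.
  set M' : ℝ := M + 2 * Real.exp L * Real.exp μ + 6 * M * Real.exp μ * Real.exp L with hM'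
  have e1 := Real.exp_pos L
  have e2 := Real.exp_pos μ
  have m1 : 0 < 2 * Real.exp L * Real.exp μ := by positivity
  have m2 : 0 < 6 * M * Real.exp μ * Real.exp L := by positivity
  refine ⟨M', by positivity, μ, hμ, fun s x v hs H t ht => ⟨(hx s x v hs H t ht).trans ?_, ?_⟩⟩
  · gcongr
    linarith
  rcases le_or_gt t (s + 1) with h1 | h1
  · have g1 := hgr s x v hs H t ht h1
    have g2 : 1 ≤ Real.exp μ * Real.exp (-(μ * (t - s))) := by
      rw [← Real.exp_add]
      exact Real.one_le_exp (by nlinarith)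
    calc |v t| ≤ 2 * (|x s| + |v s|) * Real.exp L := g1
      _ ≤ 2 * (|x s| + |v s|) * Real.exp L * (Real.exp μ * Real.exp (-(μ * (t - s)))) :=
        le_mul_of_one_le_right (by positivity) g2
      _ = (2 * Real.exp L * Real.exp μ) * Real.exp (-(μ * (t - s))) * (|x s| + |v s|) := by ring
      _ ≤ _ := by gcongr; linarith
  -- The mean value theorem finds a time within the last unit where `v` is bounded by two values of
  -- `x`, which decay; the growth bound carries this to `t` at the cost of a constant.
  · obtain ⟨ξ, hξ, hvξ⟩ := exists_hasDerivAt_eq_slope x v (a := t - 1) (b := t) (by linarith)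
      (H.continuousOn_fst.mono fun r hr => by
        have := hr.1; simp only [Set.mem_Ici]; linarith)
      (fun r hr => H.hasDerivAt (by have := hr.1; linarith))
    have hsξ : s ≤ ξ := by have := hξ.1; linarith
    have hbd : ∀ r, t - 1 ≤ r → r ≤ t →
        |x r| ≤ M * (Real.exp μ * Real.exp (-(μ * (t - s)))) * (|x s| + |v s|) := by
      intro r hr hr'
      refine (hx s x v hs H r (by linarith)).trans ?_
      rw [← Real.exp_add]
      gcongr
      nlinarith
    have h2 : |v ξ| ≤ |x t| + |x (t - 1)| := by
      rw [hvξ, sub_sub_cancel, div_one]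
      exact abs_sub _ _
    have h3 := hgr ξ x v (hs.trans hsξ) (H.mono hsξ) t hξ.2.le (by have := hξ.1; linarith)
    have h4 := hbd t (by linarith) le_rfl
    have h5 := hbd (t - 1) le_rfl (by linarith)
    have h6 := hbd ξ hξ.1.le hξ.2.le
    calc |v t| ≤ 2 * (|x ξ| + |v ξ|) * Real.exp L := h3
      _ ≤ 2 * (3 * (M * (Real.exp μ * Real.exp (-(μ * (t - s)))) * (|x s| + |v s|))) *
          Real.exp L := by gcongr; linarith
      _ = (6 * M * Real.exp μ * Real.exp L) * Real.exp (-(μ * (t - s))) * (|x s| + |v s|) := by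
        ring
      _ ≤ _ := by gcongr; linarith

end

/-! ### Kernel integrals and exponential weights. -/

theorem integral_exp_neg_mul_sub {c : ℝ} (hc : c ≠ 0) (s t : ℝ) :
    ∫ r in s..t, Real.exp (-(c * (t - r))) = (1 - Real.exp (-(c * (t - s)))) / c := by
  have hd : ∀ r ∈ Set.uIcc s t, HasDerivAt (fun r => Real.exp (-(c * (t - r))) / c)
      (Real.exp (-(c * (t - r)))) r := by
    intro r _
    have := ((((hasDerivAt_id r).const_sub t).const_mul c).neg.exp).div_const c
    convert! this using 1
    simp only [id, Pi.neg_apply]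
    field_simp
  rw [intervalIntegral.integral_eq_sub_of_hasDerivAt hd
    (Continuous.intervalIntegrable (by fun_prop) _ _)]
  simp
  ring

/-- The excess `|κ| (exp (l (t - s)) - 1)` is at most `M (exp (-(μ - l) (t - s)) - exp (-μ (t -
s)))`, whose integral is explicit. The resulting error tends to `0` with `l`. -/
theorem weighted_integral_le {κ : ℝ → ℝ} {t₁ t M μ l Y : ℝ} (ht : t₁ ≤ t) (hM : 0 ≤ M)
    (hl : 0 < l) (hlμ : l < μ) (hc : ContinuousOn κ (Set.Icc t₁ t))
    (hκ : ∀ s ∈ Set.Icc t₁ t, |κ s| ≤ M * Real.exp (-(μ * (t - s))))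
    (hY : ∫ s in t₁..t, |κ s| ≤ Y) :
    ∫ s in t₁..t, |κ s| * Real.exp (l * (t - s)) ≤ Y + M * (1 / (μ - l) - 1 / μ) := by
  have hμ : 0 < μ := hl.trans hlμ
  have hμl : 0 < μ - l := by linarith
  rw [← Set.uIcc_of_le ht] at hc
  have i1 : IntervalIntegrable (fun s => |κ s|) volume t₁ t := hc.abs.intervalIntegrable
  have ie : ∀ c : ℝ, IntervalIntegrable (fun s => Real.exp (-(c * (t - s)))) volume t₁ t :=
    fun c => Continuous.intervalIntegrable (by fun_prop) _ _
  have i0 : IntervalIntegrable (fun s => |κ s| * Real.exp (l * (t - s))) volume t₁ t :=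
    (hc.abs.mul (Continuous.continuousOn (by fun_prop))).intervalIntegrable
  have i2 := ((ie (μ - l)).sub (ie μ)).const_mul M
  have hle : ∫ s in t₁..t, |κ s| * Real.exp (l * (t - s)) ≤
      ∫ s in t₁..t, (|κ s| +
        M * (Real.exp (-((μ - l) * (t - s))) - Real.exp (-(μ * (t - s))))) := by
    refine intervalIntegral.integral_mono_on ht i0 (i1.add i2) fun s hs => ?_
    have h1 : 1 ≤ Real.exp (l * (t - s)) :=
      Real.one_le_exp (mul_nonneg hl.le (by linarith [hs.2]))
    have h2 : Real.exp (-((μ - l) * (t - s))) =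
        Real.exp (-(μ * (t - s))) * Real.exp (l * (t - s)) := by
      rw [← Real.exp_add]; congr 1; ring
    have h3 := mul_le_mul_of_nonneg_right (hκ s hs) (sub_nonneg.2 h1)
    rw [h2]
    linarith
  rw [intervalIntegral.integral_add i1 i2, intervalIntegral.integral_const_mul,
    intervalIntegral.integral_sub (ie _) (ie _), integral_exp_neg_mul_sub hμl.ne',
    integral_exp_neg_mul_sub hμ.ne'] at hle
  have h4 : Real.exp (-(μ * (t - t₁))) / μ ≤ Real.exp (-((μ - l) * (t - t₁))) / (μ - l) := by
    gcongr
    · linarith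
    · linarith
  have h5 : (1 - Real.exp (-((μ - l) * (t - t₁)))) / (μ - l) -
      (1 - Real.exp (-(μ * (t - t₁)))) / μ ≤ 1 / (μ - l) - 1 / μ := by
    rw [sub_div, sub_div]
    linarith
  have := mul_le_mul_of_nonneg_left h5 hM
  linarith

/-- Finiteness is part of the claim because `toReal` sends `∞` to `0`; without it the smallness
condition could not be read in the reals. -/
theorem iSup_lintegral_kernel {Φ κ : ℝ → ℝ → ℝ} {t₀ M μ : ℝ} (hM : 0 ≤ M) (hμ : 0 < μ)
    (hΦ : ∀ s t, t₀ ≤ s → s < t → Φ t s = κ t s)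
    (hc : ∀ t, t₀ ≤ t → ContinuousOn (κ t) (Set.Icc t₀ t))
    (hκ : ∀ s t, t₀ ≤ s → s ≤ t → |κ t s| ≤ M * Real.exp (-(μ * (t - s)))) :
    (⨆ t : Set.Ioi t₀, ∫⁻ s in Set.Ioc t₀ t, ‖Φ t s‖ₑ) ≠ ∞ ∧
    ∀ t₁ t, t₀ ≤ t₁ → t₁ ≤ t → ∫ s in t₁..t, |κ t s| ≤
      (⨆ t : Set.Ioi t₀, ∫⁻ s in Set.Ioc t₀ t, ‖Φ t s‖ₑ).toReal := by
  have hint : ∀ t, t₀ ≤ t → IntervalIntegrable (κ t) volume t₀ t := fun t ht => by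
    have := hc t ht
    rw [← Set.uIcc_of_le ht] at this
    exact this.intervalIntegrable
  have heq : ∀ t, t₀ ≤ t →
      ∫⁻ s in Set.Ioc t₀ t, ‖Φ t s‖ₑ = ENNReal.ofReal (∫ s in t₀..t, |κ t s|) := by
    intro t ht
    have h1 : ∫⁻ s in Set.Ioc t₀ t, ‖Φ t s‖ₑ = ∫⁻ s in Set.Ioc t₀ t, ‖κ t s‖ₑ := by
      refine lintegral_congr_ae ?_
      rw [Filter.EventuallyEq, ae_restrict_iff' measurableSet_Ioc]
      have : ∀ᵐ s : ℝ, s ≠ t := by simp [ae_iff, measure_singleton]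
      filter_upwards [this] with s hs hs'
      rw [hΦ s t hs'.1.le (lt_of_le_of_ne hs'.2 hs)]
    rw [h1, intervalIntegral.integral_of_le ht]
    exact (ofReal_integral_norm_eq_lintegral_enorm (hint t ht).1).symm
  have hbd : ∀ t, t₀ ≤ t → ∫ s in t₀..t, |κ t s| ≤ M / μ := by
    intro t ht
    calc ∫ s in t₀..t, |κ t s| ≤ ∫ s in t₀..t, M * Real.exp (-(μ * (t - s))) :=
          intervalIntegral.integral_mono_on ht (hint t ht).abs
            (Continuous.intervalIntegrable (by fun_prop) _ _)
            fun s hs => hκ s t hs.1 hs.2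
      _ = M * ((1 - Real.exp (-(μ * (t - t₀)))) / μ) := by
          rw [intervalIntegral.integral_const_mul, integral_exp_neg_mul_sub hμ.ne']
      _ ≤ M * (1 / μ) := by
          gcongr
          linarith [Real.exp_pos (-(μ * (t - t₀)))]
      _ = M / μ := by ring
  have hfin : (⨆ t : Set.Ioi t₀, ∫⁻ s in Set.Ioc t₀ t, ‖Φ t s‖ₑ) ≠ ∞ := by
    refine ne_top_of_le_ne_top (b := ENNReal.ofReal (M / μ)) ENNReal.ofReal_ne_top
      (iSup_le fun t => ?_)
    rw [heq t t.2.le]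
    exact ENNReal.ofReal_le_ofReal (hbd t t.2.le)
  refine ⟨hfin, fun t₁ t h01 h1t => ?_⟩
  rcases (h01.trans h1t).eq_or_lt with h | h
  · have : t₁ = t := le_antisymm h1t (h ▸ h01)
    rw [this, intervalIntegral.integral_same]
    exact ENNReal.toReal_nonneg
  · have h2 : ∫ s in t₁..t, |κ t s| ≤ ∫ s in t₀..t, |κ t s| :=
      intervalIntegral.integral_mono_interval h01 h1t le_rfl
        (Filter.Eventually.of_forall fun s => abs_nonneg _) (hint t h.le).abs
    refine h2.trans ?_
    have h3 := le_iSup (fun t : Set.Ioi t₀ => ∫⁻ s in Set.Ioc t₀ (t : ℝ), ‖Φ t s‖ₑ) ⟨t, h⟩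
    rw [heq t h.le] at h3
    exact (ENNReal.ofReal_le_iff_le_toReal hfin).1 h3

/-- The expression is continuous in `l` at `0`, where it equals `A * Y' + B * Y`. -/
theorem exists_weight {A B Y Y' : ℝ} (τ M : ℝ) {μ : ℝ} (hμ : 0 < μ) (h : A * Y' + B * Y < 1) :
    ∃ l, 0 < l ∧ l < μ ∧ Real.exp (l * τ) *
      (A * (Y' + M * (1 / (μ - l) - 1 / μ)) + B * (Y + M * (1 / (μ - l) - 1 / μ))) < 1 := by
  have hcont : ContinuousAt (fun l => Real.exp (l * τ) *
      (A * (Y' + M * (1 / (μ - l) - 1 / μ)) + B * (Y + M * (1 / (μ - l) - 1 / μ)))) 0 := by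
    have : μ - 0 ≠ 0 := by simpa using hμ.ne'
    fun_prop (disch := assumption)
  have hlt := hcont.eventually_lt (g := fun _ => (1 : ℝ)) continuousAt_const (by simpa using h)
  have h1 : ∀ᶠ l in nhdsWithin (0 : ℝ) (Set.Ioi 0), 0 < l ∧ l < μ :=
    Ioo_mem_nhdsGT hμ
  obtain ⟨l, hl, hl'⟩ := (h1.and (hlt.filter_mono nhdsWithin_le_nhds)).exists
  exact ⟨l, hl.1, hl.2, hl'⟩

/-- On a compact interval the weighted supremum is finite and attained, so an estimate at the
maximizing time `τ` bounds `P` itself and absorption is legitimate. -/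
theorem exists_weighted_bound {u : ℝ → ℝ} {t₁ T : ℝ} (l : ℝ) (hT : t₁ ≤ T)
    (hu : ContinuousOn u (Set.Icc t₁ T)) :
    ∃ τ ∈ Set.Icc t₁ T, ∃ P, 0 ≤ P ∧ |u τ| = P * Real.exp (-(l * (τ - t₁))) ∧
      ∀ t ∈ Set.Icc t₁ T, |u t| ≤ P * Real.exp (-(l * (t - t₁))) := by
  have hcont : ContinuousOn (fun t => Real.exp (l * (t - t₁)) * |u t|) (Set.Icc t₁ T) := by
    fun_prop
  obtain ⟨τ, hτ, hmax⟩ := isCompact_Icc.exists_isMaxOn (Set.nonempty_Icc.2 hT) hcont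
  refine ⟨τ, hτ, Real.exp (l * (τ - t₁)) * |u τ|, by positivity, ?_, fun t ht => ?_⟩
  · rw [mul_right_comm, ← Real.exp_add, add_neg_cancel, Real.exp_zero, one_mul]
  · have h1 : Real.exp (l * (t - t₁)) * |u t| ≤ Real.exp (l * (τ - t₁)) * |u τ| := hmax ht
    rw [Real.exp_neg, ← div_eq_mul_inv, le_div_iff₀ (Real.exp_pos _)]
    linarith

/-- Going back by at most `τ` costs `exp (l τ)` in the weight. Times before `t₁` are reached only
when `s - t₁ ≤ τ`, where the weighted factor is at least one and `G` suffices. -/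
theorem abs_delayed_le {u : ℝ → ℝ} {t₁ T P G l τ s r : ℝ} (hl : 0 ≤ l) (hP : 0 ≤ P) (hG : 0 ≤ G)
    (hu : ∀ t ∈ Set.Icc t₁ T, |u t| ≤ P * Real.exp (-(l * (t - t₁))))
    (hu' : ∀ t < t₁, |u t| ≤ G) (hs : s ≤ T) (hr : r ≤ s) (hτ : s - τ ≤ r) :
    |u r| ≤ Real.exp (l * τ) * (P + G) * Real.exp (-(l * (s - t₁))) := by
  rw [mul_right_comm, ← Real.exp_add]
  rcases lt_or_ge r t₁ with h | h
  · have h1 : 1 ≤ Real.exp (l * τ + -(l * (s - t₁))) := Real.one_le_exp (by nlinarith)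
    calc |u r| ≤ P + G := by linarith [hu' r h]
      _ ≤ _ := le_mul_of_one_le_left (by positivity) h1
  · have h1 : Real.exp (-(l * (r - t₁))) ≤ Real.exp (l * τ + -(l * (s - t₁))) := by
      gcongr
      nlinarith
    calc |u r| ≤ P * Real.exp (-(l * (r - t₁))) := hu r ⟨h, hr.trans hs⟩
      _ ≤ (P + G) * Real.exp (l * τ + -(l * (s - t₁))) := by
        gcongr
        linarith
      _ = _ := mul_comm _ _

/-- The integral term of the variation of constants formula in weighted norms. -/
theorem abs_integral_kernel_le {κ f : ℝ → ℝ} {t₁ t Φ l Y : ℝ} (ht : t₁ ≤ t) (hΦ : 0 ≤ Φ)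
    (hc : ContinuousOn κ (Set.Icc t₁ t))
    (hf : ∀ᵐ s, s ∈ Set.Ioc t₁ t → |f s| ≤ Φ * Real.exp (-(l * (s - t₁))))
    (hY : ∫ s in t₁..t, |κ s| * Real.exp (l * (t - s)) ≤ Y) :
    |∫ s in t₁..t, κ s * f s| ≤ Φ * Y * Real.exp (-(l * (t - t₁))) := by
  rw [← Set.uIcc_of_le ht] at hc
  have i0 : IntervalIntegrable (fun s => |κ s| * Real.exp (l * (t - s))) volume t₁ t :=
    (hc.abs.mul (Continuous.continuousOn (by fun_prop))).intervalIntegrable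
  calc |∫ s in t₁..t, κ s * f s|
      ≤ ∫ s in t₁..t, Φ * Real.exp (-(l * (t - t₁))) * (|κ s| * Real.exp (l * (t - s))) := by
        rw [← Real.norm_eq_abs]
        refine intervalIntegral.norm_integral_le_of_norm_le ht ?_ (i0.const_mul _)
        filter_upwards [hf] with s hs hs'
        have e : Real.exp (-(l * (s - t₁))) =
            Real.exp (-(l * (t - t₁))) * Real.exp (l * (t - s)) := by
          rw [← Real.exp_add]; congr 1; ring
        rw [norm_mul, Real.norm_eq_abs, Real.norm_eq_abs]
        calc |κ s| * |f s| ≤ |κ s| * (Φ * Real.exp (-(l * (s - t₁)))) := by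
              gcongr; exact hs hs'
          _ = _ := by rw [e]; ring
    _ = Φ * Real.exp (-(l * (t - t₁))) * ∫ s in t₁..t, |κ s| * Real.exp (l * (t - s)) :=
        intervalIntegral.integral_const_mul _ _
    _ ≤ Φ * Real.exp (-(l * (t - t₁))) * Y := by gcongr
    _ = _ := by ring

/-! ### The delay equation in weighted norms. -/

/-- Exponential decay on `[t₁, ∞)`, where the delays are bounded by `τ` and the perturbation is a
contraction in the weighted norm. -/
theorem IsKernel.decay {a b : ℝ → ℝ} {k k' : ℝ → ℝ → ℝ} (hk : IsKernel a b k k')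
    {f g h x v : ℝ → ℝ} {t₁ M l τ A B Y Y' G : ℝ} (ht₁ : 0 ≤ t₁) (H : IsTraj a b f t₁ x v)
    (hM : 0 ≤ M) (hl : 0 ≤ l) (hA : 0 ≤ A) (hB : 0 ≤ B) (hG : 0 ≤ G)
    (hdecay : ∀ y w, IsTraj a b 0 t₁ y w → ∀ t, t₁ ≤ t →
      |y t| ≤ M * Real.exp (-(l * (t - t₁))) * (|y t₁| + |w t₁|) ∧
      |w t| ≤ M * Real.exp (-(l * (t - t₁))) * (|y t₁| + |w t₁|))
    (hY : ∀ t, t₁ ≤ t → ∫ s in t₁..t, |k t s| * Real.exp (l * (t - s)) ≤ Y)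
    (hY' : ∀ t, t₁ ≤ t → ∫ s in t₁..t, |k' t s| * Real.exp (l * (t - s)) ≤ Y')
    (hq : Real.exp (l * τ) * (A * Y' + B * Y) < 1)
    (hf : ∀ᵐ t, t₁ ≤ t → |f t| ≤ A * |v (g t)| + B * |x (h t)|)
    (hg : ∀ t, t₁ ≤ t → g t ≤ t ∧ t - τ ≤ g t) (hh : ∀ t, t₁ ≤ t → h t ≤ t ∧ t - τ ≤ h t)
    (hinit : |x t₁| + |v t₁| ≤ G) (hx : ∀ t < t₁, |x t| ≤ G) (hv : ∀ t < t₁, |v t| ≤ G)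
    {T : ℝ} (hT : t₁ ≤ T) :
    |x T| ≤ (M + Real.exp (l * τ) * ((A + B) * (M + 1) / (1 - Real.exp (l * τ) *
      (A * Y' + B * Y)) + (A + B)) * Y) * G * Real.exp (-(l * (T - t₁))) := by
  set E := Real.exp (l * τ) with hE
  have hE0 : 0 < E := Real.exp_pos _
  set q := E * (A * Y' + B * Y) with hqdef
  have hY0 : 0 ≤ Y := by simpa using hY t₁ le_rfl
  have hY'0 : 0 ≤ Y' := by simpa using hY' t₁ le_rfl
  obtain ⟨τ₁, hτ₁, P, hP0, hPeq, hP⟩ := exists_weighted_bound l hT (H.continuousOn_fst_Icc T)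
  obtain ⟨τ₂, hτ₂, Q, hQ0, hQeq, hQ⟩ := exists_weighted_bound l hT (H.continuousOn_snd_Icc hT)
  set Φ := E * (A * (Q + G) + B * (P + G)) with hΦ
  have hΦ0 : 0 ≤ Φ := by positivity
  have hfΦ : ∀ᵐ s, s ∈ Set.Icc t₁ T → |f s| ≤ Φ * Real.exp (-(l * (s - t₁))) := by
    filter_upwards [hf] with s hs hsI
    have e1 := abs_delayed_le hl hQ0 hG hQ hv hsI.2 (hg s hsI.1).1 (hg s hsI.1).2
    have e2 := abs_delayed_le hl hP0 hG hP hx hsI.2 (hh s hsI.1).1 (hh s hsI.1).2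
    calc |f s| ≤ A * |v (g s)| + B * |x (h s)| := hs hsI.1
      _ ≤ A * (E * (Q + G) * Real.exp (-(l * (s - t₁)))) +
          B * (E * (P + G) * Real.exp (-(l * (s - t₁)))) := by gcongr
      _ = _ := by rw [hΦ]; ring
  obtain ⟨y, w, Hy, hy, hw, hrep⟩ := hk.representation f t₁ x v ht₁ H
  have hest : ∀ t ∈ Set.Icc t₁ T,
      |x t| ≤ (M * G + Φ * Y) * Real.exp (-(l * (t - t₁))) ∧
      |v t| ≤ (M * G + Φ * Y') * Real.exp (-(l * (t - t₁))) := by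
    intro t ht
    have ht0 := ht₁.trans ht.1
    have hsub : Set.Icc t₁ t ⊆ Set.Icc 0 t := Set.Icc_subset_Icc_left ht₁
    have hft : ∀ᵐ s, s ∈ Set.Ioc t₁ t → |f s| ≤ Φ * Real.exp (-(l * (s - t₁))) := by
      filter_upwards [hfΦ] with s hs hs' using hs ⟨hs'.1.le, hs'.2.trans ht.2⟩
    have j1 := abs_integral_kernel_le ht.1 hΦ0 ((hk.continuousOn t ht0).mono hsub) hft (hY t ht.1)
    have j2 := abs_integral_kernel_le ht.1 hΦ0 ((hk.continuousOn_deriv t ht0).mono hsub) hft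
      (hY' t ht.1)
    obtain ⟨d1, d2⟩ := hdecay y w Hy t ht.1
    rw [hy, hw] at d1 d2
    have hMG : M * Real.exp (-(l * (t - t₁))) * (|x t₁| + |v t₁|) ≤
        M * Real.exp (-(l * (t - t₁))) * G := by gcongr
    rw [(hrep t ht.1).1, (hrep t ht.1).2]
    constructor
    · refine (abs_sub _ _).trans ?_
      linarith
    · refine (abs_sub _ _).trans ?_
      linarith
  have hPle : P ≤ M * G + Φ * Y := by
    have := (hest τ₁ hτ₁).1
    rw [hPeq] at this
    exact le_of_mul_le_mul_right this (Real.exp_pos _)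
  have hQle : Q ≤ M * G + Φ * Y' := by
    have := (hest τ₂ hτ₂).2
    rw [hQeq] at this
    exact le_of_mul_le_mul_right this (Real.exp_pos _)
  -- The contraction acts on the combination `R = A Q + B P`: the estimates give `R ≤ (A + B) M G +
  -- q R + q (A + B) G`, and `q < 1` allows solving for `R`. The bound does not involve `T`.
  have hR : A * Q + B * P ≤ (A + B) * (M + 1) / (1 - q) * G := by
    have h1 : A * Q + B * P ≤ A * (M * G + Φ * Y') + B * (M * G + Φ * Y) := by gcongr
    have h2 : A * (M * G + Φ * Y') + B * (M * G + Φ * Y) =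
        (A + B) * M * G + q * (A * Q + B * P) + q * ((A + B) * G) := by
      rw [hΦ, hqdef]; ring
    have h3 : q * ((A + B) * G) ≤ 1 * ((A + B) * G) := by gcongr
    rw [div_mul_eq_mul_div, le_div_iff₀ (by linarith)]
    linarith
  have hΦle : Φ ≤ E * ((A + B) * (M + 1) / (1 - q) + (A + B)) * G := by
    have : A * (Q + G) + B * (P + G) ≤ ((A + B) * (M + 1) / (1 - q) + (A + B)) * G := by linarith
    calc Φ ≤ E * (((A + B) * (M + 1) / (1 - q) + (A + B)) * G) := by rw [hΦ]; gcongr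
      _ = _ := by ring
  refine (hest T ⟨hT, le_rfl⟩).1.trans ?_
  have := mul_le_mul_of_nonneg_right hΦle hY0
  gcongr
  linarith

theorem IsDelay.exists_bound {g : ℝ → ℝ} (hg : IsDelay g) :
    ∃ S τ, ∀ t, S ≤ t → t - τ ≤ g t := by
  obtain ⟨τ, hτ⟩ := hg.bounded
  rw [Filter.eventually_map, Filter.eventually_atTop] at hτ
  obtain ⟨S, hS⟩ := hτ
  exact ⟨S, τ, fun t ht => by linarith [hS t ht]⟩

theorem IsSolution.growth {a b a₁ b₁ g h : ℝ → ℝ} {t₀ : ℝ} {φ ψ : Set.Iio t₀ → ℝ} {x₀ x₀' : ℝ}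
    {x v : ℝ → ℝ} (H : IsSolution a b a₁ b₁ g h t₀ φ ψ x₀ x₀' x v) (ht₀ : 0 ≤ t₀) {K D : ℝ}
    (hK : 0 ≤ K) (hD : 0 ≤ D)
    (ha : ∀ᵐ t, (0 : ℝ) ≤ t → |a t| ≤ K) (hb : ∀ᵐ t, (0 : ℝ) ≤ t → |b t| ≤ K)
    (ha₁ : ∀ᵐ t, (0 : ℝ) ≤ t → |a₁ t| ≤ K) (hb₁ : ∀ᵐ t, (0 : ℝ) ≤ t → |b₁ t| ≤ K)
    (hg : IsDelay g) (hh : IsDelay h) (hx : ∀ t < t₀, |x t| ≤ D) (hv : ∀ t < t₀, |v t| ≤ D)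
    {T : ℝ} (hT : t₀ ≤ T) :
    |x T| + |v T| ≤ 2 * (|x₀| + |x₀'| + 2 * D) * Real.exp (2 * (3 * K + 1) * (T - t₀)) := by
  have hpast : ∀ u : ℝ → ℝ, (∀ t < t₀, |u t| ≤ D) → ∀ t r, t₀ ≤ t → r ≤ t →
      ∃ q ∈ Set.Icc t₀ t, |u r| ≤ D + |u q| := by
    intro u hu t r ht hr
    rcases lt_or_ge r t₀ with h1 | h1
    · exact ⟨t₀, ⟨le_rfl, ht⟩, by linarith [hu r h1, abs_nonneg (u t₀)]⟩
    · exact ⟨r, ⟨h1, hr⟩, by linarith⟩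
  -- One `D` for each of the two delayed arguments, either of which may fall into the history.
  have := H.isTraj.growth (D := 2 * D) hK (by positivity)
    (by filter_upwards [ha] with t h ht using h (ht₀.trans ht))
    (by filter_upwards [hb] with t h ht using h (ht₀.trans ht)) (by
      filter_upwards [ha₁, hb₁] with t h1 h2 ht
      have ht0 := ht₀.trans ht
      obtain ⟨r, hr, hvr⟩ := hpast v hv t (g t) ht (hg.le_self t ht0)
      obtain ⟨q, hq, hxq⟩ := hpast x hx t (h t) ht (hh.le_self t ht0)
      refine ⟨r, hr, q, hq, ?_⟩
      calc |a₁ t * v (g t) + b₁ t * x (h t)| ≤ |a₁ t| * |v (g t)| + |b₁ t| * |x (h t)| := by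
            rw [← abs_mul, ← abs_mul]; exact abs_add_le _ _
        _ ≤ K * (D + |v r|) + K * (D + |x q|) := by
            gcongr
            · exact h1 ht0
            · exact h2 ht0
        _ = _ := by ring) hT
  rwa [H.initial, H.initial_deriv] at this

end DelayEq

/-! ### Assembly of the constants. -/

theorem theorem1 (a b a₁ b₁ g h : ℝ → ℝ)
    (ha : DelayEq.IsCoeff a) (hb : DelayEq.IsCoeff b)
    (ha₁ : DelayEq.IsCoeff a₁) (hb₁ : DelayEq.IsCoeff b₁)
    (hg : DelayEq.IsDelay g) (hh : DelayEq.IsDelay h)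
    (ha_nonneg : ∀ᵐ t ∂volume.restrict (Set.Ici (0 : ℝ)), 0 ≤ a t)
    (hb_nonneg : ∀ᵐ t ∂volume.restrict (Set.Ici (0 : ℝ)), 0 ≤ b t)
    (hstable : DelayEq.ODEExpStable a b)
    (hsmall : ∃ t₀ : ℝ, 0 ≤ t₀ ∧
      eLpNorm a₁ ∞ (volume.restrict (Set.Ici t₀)) * DelayEq.supIntDeriv a b t₀ +
        eLpNorm b₁ ∞ (volume.restrict (Set.Ici t₀)) * DelayEq.supInt a b t₀ < 1) :
    DelayEq.ExpStable a b a₁ b₁ g h := by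
  obtain ⟨t₀, ht₀, hsmall⟩ := hsmall
  obtain ⟨K₁, hK₁, haK⟩ := ha.exists_bound
  obtain ⟨K₂, hK₂, hbK⟩ := hb.exists_bound
  obtain ⟨K₃, hK₃, ha₁K⟩ := ha₁.exists_bound
  obtain ⟨K₄, hK₄, hb₁K⟩ := hb₁.exists_bound
  set K := K₁ + K₂ + K₃ + K₄
  have hK : 0 ≤ K := by positivity
  replace haK : ∀ᵐ t, (0 : ℝ) ≤ t → |a t| ≤ K := by
    filter_upwards [haK] with t h1 ht using (h1 ht).trans (by linarith)
  replace hbK : ∀ᵐ t, (0 : ℝ) ≤ t → |b t| ≤ K := by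
    filter_upwards [hbK] with t h1 ht using (h1 ht).trans (by linarith)
  replace ha₁K : ∀ᵐ t, (0 : ℝ) ≤ t → |a₁ t| ≤ K := by
    filter_upwards [ha₁K] with t h1 ht using (h1 ht).trans (by linarith)
  replace hb₁K : ∀ᵐ t, (0 : ℝ) ≤ t → |b₁ t| ≤ K := by
    filter_upwards [hb₁K] with t h1 ht using (h1 ht).trans (by linarith)
  obtain ⟨M, hM, μ, hμ, hdecay⟩ := hstable.decay hK haK hbK
  obtain ⟨x₁, v₁, x₂, v₂, p, S⟩ := DelayEq.exists_fundamentalSystem ha hb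
  obtain ⟨k, k', hk⟩ : ∃ k k', DelayEq.IsKernel a b k k' := ⟨_, _, S.isKernel⟩
  have hkb : ∀ s t, t₀ ≤ s → s ≤ t → |k t s| ≤ M * Real.exp (-(μ * (t - s))) ∧
      |k' t s| ≤ M * Real.exp (-(μ * (t - s))) := by
    intro s t hs hst
    have hs0 := ht₀.trans hs
    have := hdecay s _ _ hs0 (hk.traj s hs0) t hst
    simpa [hk.diag s hs0, hk.diag_deriv s hs0] using this
  obtain ⟨hYtop, hYint⟩ := DelayEq.iSup_lintegral_kernel (Φ := DelayEq.fundamental a b) (κ := k)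
    (t₀ := t₀) hM.le hμ (fun s t hs hst => hk.fundamental_eq hK haK hbK (ht₀.trans hs) hst.le)
    (fun t ht => (hk.continuousOn t (ht₀.trans ht)).mono (Set.Icc_subset_Icc_left ht₀))
    (fun s t hs hst => (hkb s t hs hst).1)
  obtain ⟨hY'top, hY'int⟩ := DelayEq.iSup_lintegral_kernel
    (Φ := fun t s => deriv (fun τ => DelayEq.fundamental a b τ s) t) (κ := k')
    (t₀ := t₀) hM.le hμ (fun s t hs hst => hk.deriv_fundamental_eq hK haK hbK (ht₀.trans hs) hst)
    (fun t ht => (hk.continuousOn_deriv t (ht₀.trans ht)).mono (Set.Icc_subset_Icc_left ht₀))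
    (fun s t hs hst => (hkb s t hs hst).2)
  change DelayEq.supInt a b t₀ ≠ ∞ at hYtop
  change DelayEq.supIntDeriv a b t₀ ≠ ∞ at hY'top
  change ∀ t₁ t, t₀ ≤ t₁ → t₁ ≤ t → _ ≤ (DelayEq.supInt a b t₀).toReal at hYint
  change ∀ t₁ t, t₀ ≤ t₁ → t₁ ≤ t → _ ≤ (DelayEq.supIntDeriv a b t₀).toReal at hY'int
  set Y := (DelayEq.supInt a b t₀).toReal
  set Y' := (DelayEq.supIntDeriv a b t₀).toReal
  set A := (eLpNorm a₁ ∞ (volume.restrict (Set.Ici t₀))).toReal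
  set B := (eLpNorm b₁ ∞ (volume.restrict (Set.Ici t₀))).toReal
  have hsum : A * Y' + B * Y < 1 := by
    have h1 := (ENNReal.toReal_lt_toReal hsmall.ne_top ENNReal.one_ne_top).2 hsmall
    rwa [ENNReal.toReal_add (ENNReal.mul_ne_top (ha₁.eLpNorm_ne_top ht₀) hY'top)
      (ENNReal.mul_ne_top (hb₁.eLpNorm_ne_top ht₀) hYtop), ENNReal.toReal_mul,
      ENNReal.toReal_mul, ENNReal.toReal_one] at h1
  obtain ⟨Sg, τg, hSg⟩ := hg.exists_bound
  obtain ⟨Sh, τh, hSh⟩ := hh.exists_bound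
  set τ := max τg τh
  -- Past `T₁` both delays are at most `τ` and the norms over `[t₀, ∞)` apply.
  set T₁ := max t₀ (max Sg Sh)
  have hT₁0 : 0 ≤ T₁ := ht₀.trans (le_max_left _ _)
  obtain ⟨l, hl, hlμ, hq⟩ := DelayEq.exists_weight τ M hμ hsum
  set ε := M * (1 / (μ - l) - 1 / μ)
  set C := M + Real.exp (l * τ) * ((A + B) * (M + 1) / (1 - Real.exp (l * τ) *
      (A * (Y' + ε) + B * (Y + ε))) + (A + B)) * (Y + ε)
  have hε : 0 ≤ ε := mul_nonneg hM.le (sub_nonneg.2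
    (one_div_le_one_div_of_le (by linarith) (by linarith)))
  have hC0 : 0 ≤ C := by
    have h1 : 0 ≤ 1 - Real.exp (l * τ) * (A * (Y' + ε) + B * (Y + ε)) := by linarith
    have h2 : 0 ≤ A := ENNReal.toReal_nonneg
    have h3 : 0 ≤ B := ENNReal.toReal_nonneg
    have h4 : 0 ≤ Y := ENNReal.toReal_nonneg
    positivity
  set L := 2 * (3 * K + 1)
  have hL0 : 0 ≤ L := by positivity
  -- The factor `4 * exp (L * T₁)` bounds the solution up to `t₁ = max τ₀ T₁`, as `t₁ - τ₀ ≤ T₁`;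
  -- `C` is the constant of the decay after `t₁`, and adding `1` covers `t ≤ t₁`; `exp (l * T₁)`
  -- converts decay measured from `t₁` into decay measured from `τ₀`.
  refine ⟨(C + 1) * (4 * Real.exp (L * T₁)) * Real.exp (l * T₁), by positivity, l, hl, ?_⟩
  intro τ₀ hτ₀ φ ψ _ _ ⟨Cφ, hCφ⟩ ⟨Cψ, hCψ⟩ x₀ x₀' x v H t ht
  set D := ⨆ s, (|φ s| + |ψ s|)
  have hbdd : BddAbove (Set.range fun s => |φ s| + |ψ s|) :=
    ⟨Cφ + Cψ, by rintro _ ⟨s, rfl⟩; exact add_le_add (hCφ s) (hCψ s)⟩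
  have hDs : ∀ s, |φ s| + |ψ s| ≤ D := fun s => le_ciSup hbdd s
  have hD0 : 0 ≤ D := Real.iSup_nonneg fun s => by positivity
  have hxD : ∀ s < τ₀, |x s| ≤ D := fun s hs => by
    rw [H.history ⟨s, hs⟩]; linarith [hDs ⟨s, hs⟩, abs_nonneg (ψ ⟨s, hs⟩)]
  have hvD : ∀ s < τ₀, |v s| ≤ D := fun s hs => by
    rw [H.history_deriv ⟨s, hs⟩]; linarith [hDs ⟨s, hs⟩, abs_nonneg (φ ⟨s, hs⟩)]
  set d := |x₀| + |x₀'| + D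
  have hd0 : 0 ≤ d := by positivity
  set G := 4 * Real.exp (L * T₁) * d with hG
  have hG0 : 0 ≤ G := by positivity
  have hDG : D ≤ G := by
    have h1 : 1 ≤ Real.exp (L * T₁) := Real.one_le_exp (by positivity)
    have h2 : d ≤ Real.exp (L * T₁) * d := le_mul_of_one_le_left hd0 h1
    have h3 : D ≤ d := by linarith [abs_nonneg x₀, abs_nonneg x₀']
    linarith
  set t₁ := max τ₀ T₁
  have ht₁τ : t₁ - τ₀ ≤ T₁ := by
    rw [sub_le_iff_le_add]; exact max_le (by linarith) (by linarith)
  have hgrow : ∀ s, τ₀ ≤ s → s ≤ t₁ → |x s| + |v s| ≤ G := by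
    intro s hs hs1
    refine (H.growth hτ₀ hK hD0 haK hbK ha₁K hb₁K hg hh hxD hvD hs).trans ?_
    have h1 : 2 * (|x₀| + |x₀'| + 2 * D) ≤ 4 * d := by linarith [abs_nonneg x₀, abs_nonneg x₀']
    have h2 : s - τ₀ ≤ T₁ := by linarith
    calc 2 * (|x₀| + |x₀'| + 2 * D) * Real.exp (L * (s - τ₀))
        ≤ 4 * d * Real.exp (L * T₁) := by gcongr
      _ = G := by rw [hG]; ring
  have hexp : ∀ s, s ≤ t₁ → Real.exp (-(l * (t - s))) ≤
      Real.exp (l * T₁) * Real.exp (-l * (t - τ₀)) := by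
    intro s hs
    rw [← Real.exp_add]
    gcongr
    nlinarith
  have hfinal : |x t| ≤ (C + 1) * G * (Real.exp (l * T₁) * Real.exp (-l * (t - τ₀))) := by
    rcases le_total t t₁ with htt | htt
    · have h1 := hexp t htt
      rw [sub_self, mul_zero, neg_zero, Real.exp_zero] at h1
      calc |x t| ≤ G := by linarith [hgrow t ht htt, abs_nonneg (v t)]
        _ ≤ (C + 1) * G := le_mul_of_one_le_left hG0 (by linarith)
        _ ≤ _ := le_mul_of_one_le_right (by positivity) h1
    · have hT₁t₁ : T₁ ≤ t₁ := le_max_right _ _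
      have ht₁0 : 0 ≤ t₁ := hT₁0.trans hT₁t₁
      have ht₀t₁ : t₀ ≤ t₁ := (le_max_left _ _).trans hT₁t₁
      have hpast : ∀ u : ℝ → ℝ, (∀ s < τ₀, |u s| ≤ D) →
          (∀ s, τ₀ ≤ s → s ≤ t₁ → |u s| ≤ G) → ∀ s < t₁, |u s| ≤ G := by
        intro u h1 h2 s hs
        rcases lt_or_ge s τ₀ with h3 | h3
        · exact (h1 s h3).trans hDG
        · exact h2 s h3 hs.le
      have hsub : ∀ r, Set.Icc t₁ r ⊆ Set.Icc 0 r := fun r => Set.Icc_subset_Icc_left ht₁0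
      have key := hk.decay (g := g) (h := h) (τ := τ) (l := l) (M := M) (A := A) (B := B)
        (Y := Y + ε) (Y' := Y' + ε) (G := G) ht₁0 (H.isTraj.mono (le_max_left τ₀ T₁)) hM.le hl.le
        ENNReal.toReal_nonneg ENNReal.toReal_nonneg hG0
        (by
          intro y w Hy r hr
          have h1 : Real.exp (-(μ * (r - t₁))) ≤ Real.exp (-(l * (r - t₁))) := by gcongr
          have h2 : M * Real.exp (-(μ * (r - t₁))) * (|y t₁| + |w t₁|) ≤
              M * Real.exp (-(l * (r - t₁))) * (|y t₁| + |w t₁|) := by gcongr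
          exact (hdecay t₁ y w ht₁0 Hy r hr).imp (fun h => h.trans h2) fun h => h.trans h2)
        (fun r hr => DelayEq.weighted_integral_le hr hM.le hl hlμ
          ((hk.continuousOn r (ht₁0.trans hr)).mono (hsub r))
          (fun s hs => (hkb s r (ht₀t₁.trans hs.1) hs.2).1) (hYint t₁ r ht₀t₁ hr))
        (fun r hr => DelayEq.weighted_integral_le hr hM.le hl hlμ
          ((hk.continuousOn_deriv r (ht₁0.trans hr)).mono (hsub r))
          (fun s hs => (hkb s r (ht₀t₁.trans hs.1) hs.2).2) (hY'int t₁ r ht₀t₁ hr))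
        hq
        (by
          filter_upwards [ha₁.ae_abs_le ht₀, hb₁.ae_abs_le ht₀] with r h1 h2 hr
          refine (abs_add_le _ _).trans ?_
          rw [abs_mul, abs_mul]
          gcongr
          · exact h1 (ht₀t₁.trans hr)
          · exact h2 (ht₀t₁.trans hr))
        (fun r hr => ⟨hg.le_self r (ht₁0.trans hr), by
          have h1 := hSg r (((le_max_left _ _).trans (le_max_right _ _)).trans (hT₁t₁.trans hr))
          have h2 : τg ≤ τ := le_max_left _ _
          linarith⟩)
        (fun r hr => ⟨hh.le_self r (ht₁0.trans hr), by
          have h1 := hSh r (((le_max_right _ _).trans (le_max_right _ _)).trans (hT₁t₁.trans hr))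
          have h2 : τh ≤ τ := le_max_right _ _
          linarith⟩)
        (hgrow t₁ (le_max_left _ _) le_rfl)
        (hpast x hxD fun s h1 h2 => by linarith [hgrow s h1 h2, abs_nonneg (v s)])
        (hpast v hvD fun s h1 h2 => by linarith [hgrow s h1 h2, abs_nonneg (x s)]) htt
      calc |x t| ≤ C * G * Real.exp (-(l * (t - t₁))) := key
        _ ≤ (C + 1) * G * (Real.exp (l * T₁) * Real.exp (-l * (t - τ₀))) := by
          gcongr
          · linarith
          · exact hexp t₁ le_rfl
  refine hfinal.trans_eq ?_
  rw [hG]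
  ring
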